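/- Let $d\ge 2$, $\lambda\in(0,d)$ and $R_0>0$. For $\widehat u:\mathbf Z^d\to\mathbf C$ put $(\Delta_{disc}\widehat u)(n)=\frac14\sum_{j=1}^d\big(\widehat u(n+e_j)+\widehat u(n-e_j)\big)-\frac d2\,\widehat u(n)$, and let $|n|$ be the Euclidean norm. Suppose that $$(-\Delta_{disc}-\lambda)\widehat u(n)=0\quad\text{for all } n\in\mathbf Z^d \text{ with } |n|>R_0,\qquad \lim_{R\to\infty}\frac1R\sum_{R_0<|n|<R}|\widehat u(n)|^2=0 .$$ Extend $\widehat u$ from $\{|n|>R_0\}$ by zero to $\{|n|\le R_0\}$ and denote the result by $\widehat u_0$; put $\widehat f=(-\Delta_{disc}-\lambda)\widehat u_0$. Let $\mathbf T^d=(\mathbf R/2\pi\mathbf Z)^d\subset\mathbf T^d_{\mathbf C}=(\mathbf C/2\pi\mathbf Z)^d$, $h(z)=\frac12\big(d-\sum_{j=1}^d\cos z_j\big)$, and $$M^{\mathbf C}_\lambda=\{z\in\mathbf T^d_{\mathbf C}\,;\,h(z)=\lambda\},\quad \mathrm{sng}\,M^{\mathbf C}_\lambda=\{z\in M^{\mathbf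 C}_\lambda\,;\,z_j\equiv 0\ (\mathrm{mod}\ \pi)\text{ for all }j\},\quad \mathrm{reg}\,M^{\mathbf C}_\lambda=M^{\mathbf C}_\lambda\setminus\mathrm{sng}\,M^{\mathbf C}_\lambda .$$ Then $\mathrm{sng}\,M^{\mathbf C}_\lambda$ is finite, $\widehat f$ is finitely supported, and the series $u=(2\pi)^{-d/2}\sum_{n}\widehat u_0(n)e^{-in\cdot x}$ converges (unconditionally, tested against each function in $C^\infty(\mathbf T^d)$) to a distribution $u$ on $\mathbf T^d$. With the trigonometric polynomial $f(x)=(2\pi)^{-d/2}\sum_n\widehat f(n)e^{-in\cdot x}$, this distribution satisfies $$(h(x)-\lambda)\,u=f\ \text{ on } \mathbf T^d,\qquad u\in C^\infty\big(\mathbf T^d\setminus \mathrm{sng}\,M^{\mathbf C}_\lambda\big),$$ and $$f(x)=0\quad\text{for all } x\in \big(\mathrm{reg}\,M^{\mathbf C}_\lambda\big)\cap\mathbf T^d .$$ -/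

import Mathlib

open Filter Topology MeasureTheory
open scoped Real ContDiff

namespace DiscreteHelmholtz

noncomputable section

/-! ### The square lattice -/

/-- The Euclidean length `|n|` of a lattice point `n ∈ ℤ^d`. -/
def latticeNorm {d : ℕ} (n : Fin d → ℤ) : ℝ :=
  Real.sqrt (∑ j, (n j : ℝ) ^ 2)

/-- The discrete Laplacian
`(Δ_disc û)(n) = (1/4) ∑_j (û(n + e_j) + û(n - e_j)) - (d/2) û(n)`. -/
def discreteLaplacian {d : ℕ} (uhat : (Fin d → ℤ) → ℂ) (n : Fin d → ℤ) : ℂ :=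
  (1 / 4 : ℂ) * ∑ j, (uhat (n + Pi.single j 1) + uhat (n - Pi.single j 1))
    - ((d : ℂ) / 2) * uhat n

/-- `(-Δ_disc - λ) û`. -/
def helmholtz {d : ℕ} (lam : ℝ) (uhat : (Fin d → ℤ) → ℂ) (n : Fin d → ℤ) : ℂ :=
  -discreteLaplacian uhat n - (lam : ℂ) * uhat n

/-- `(1/R) ∑_{R₀ < |n| < R} |û(n)|² → 0` as `R → ∞`.  Each sum has finitely many nonzero terms
(see `finite_latticeNorm_lt`). -/
def DecayCondition {d : ℕ} (R₀ : ℝ) (uhat : (Fin d → ℤ) → ℂ) : Prop :=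
  Tendsto
    (fun R : ℝ => (1 / R) *
      ∑ᶠ n ∈ {n : Fin d → ℤ | R₀ < latticeNorm n ∧ latticeNorm n < R}, ‖uhat n‖ ^ 2)
    atTop (𝓝 0)

open Classical in
/-- The sequence which is `0` for `|n| ≤ R₀` and agrees with `û` for `|n| > R₀`. -/
def zeroExtension {d : ℕ} (R₀ : ℝ) (uhat : (Fin d → ℤ) → ℂ) (n : Fin d → ℤ) : ℂ :=
  if latticeNorm n ≤ R₀ then 0 else uhat n

theorem finite_latticeNorm_lt {d : ℕ} (R : ℝ) :
    {n : Fin d → ℤ | latticeNorm n < R}.Finite := by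
  refine (Set.finite_Icc (fun _ : Fin d => -⌈R⌉) (fun _ => ⌈R⌉)).subset ?_
  intro n hn
  have key : ∀ j, |(n j : ℝ)| ≤ (⌈R⌉ : ℝ) := by
    intro j
    refine le_trans (Real.abs_le_sqrt ?_) (le_trans (le_of_lt hn) (Int.le_ceil R))
    exact Finset.single_le_sum (f := fun j => ((n j : ℝ)) ^ 2)
      (fun i _ => sq_nonneg _) (Finset.mem_univ j)
  constructor
  · intro j
    have := (abs_le.mp (key j)).1
    exact_mod_cast this
  · intro j
    have := (abs_le.mp (key j)).2
    exact_mod_cast this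

/-! ### The flat torus and its complexification -/

instance factTwoPiPos : Fact (0 < 2 * π) := ⟨Real.two_pi_pos⟩

/-- The flat torus `𝕋^d = (ℝ / 2πℤ)^d`; its volume is Lebesgue measure, of total mass `(2π)^d`. -/
abbrev Torus (d : ℕ) : Type := Fin d → AddCircle (2 * π)

/-- The complex torus `𝕋_ℂ^d = (ℂ / 2πℤ)^d`. -/
abbrev ComplexTorus (d : ℕ) : Type := Fin d → AddCircle (2 * (π : ℂ))

/-- The projection `ℝ^d → 𝕋^d`. -/
def proj {d : ℕ} (x : Fin d → ℝ) : Torus d := fun j => (x j : AddCircle (2 * π))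

/-- The inclusion `ℝ / 2πℤ → ℂ / 2πℤ`. -/
def circleToComplex : AddCircle (2 * π) → AddCircle (2 * (π : ℂ)) :=
  Function.Periodic.lift (f := fun t : ℝ => (((t : ℂ)) : AddCircle (2 * (π : ℂ)))) (by
    intro t
    have h : ((2 * π : ℝ) : ℂ) = 2 * (π : ℂ) := by push_cast; ring
    simp only [Complex.ofReal_add, h, AddCircle.coe_add_period])

/-- The inclusion `𝕋^d → 𝕋_ℂ^d`. -/
def toComplexTorus {d : ℕ} (x : Torus d) : ComplexTorus d := fun j => circleToComplex (x j)

/-- `h(x) = (1/2) (d - ∑_j cos x_j)` on `𝕋^d`. -/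
def symbol {d : ℕ} (x : Torus d) : ℝ :=
  (1 / 2) * ((d : ℝ) - ∑ j, Real.cos_periodic.lift (x j))

/-- `h(z) = (1/2) (d - ∑_j cos z_j)` on `𝕋_ℂ^d`. -/
def complexSymbol {d : ℕ} (z : ComplexTorus d) : ℂ :=
  (1 / 2) * ((d : ℂ) - ∑ j, Complex.cos_periodic.lift (z j))

theorem symbol_proj {d : ℕ} (x : Fin d → ℝ) :
    symbol (proj x) = (1 / 2) * ((d : ℝ) - ∑ j, Real.cos (x j)) := rfl

theorem complexSymbol_toComplexTorus {d : ℕ} (x : Torus d) :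
    complexSymbol (toComplexTorus x) = (symbol x : ℂ) := by
  have key : ∀ t : AddCircle (2 * π),
      Complex.cos_periodic.lift (circleToComplex t) = ((Real.cos_periodic.lift t : ℝ) : ℂ) := by
    intro t
    induction t using QuotientAddGroup.induction_on with
    | H t => exact (Complex.ofReal_cos t).symm
  simp [complexSymbol, symbol, toComplexTorus, key]

/-- The complex Fermi surface `M_λ^ℂ = {z ∈ 𝕋_ℂ^d ; h(z) = λ}`. -/
def complexFermi (d : ℕ) (lam : ℝ) : Set (ComplexTorus d) :=
  {z | complexSymbol z = (lam : ℂ)}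

/-- `sng M_λ^ℂ`: the points of `M_λ^ℂ` with `z_j ≡ 0 (mod π)` for all `j`. -/
def sngFermi (d : ℕ) (lam : ℝ) : Set (ComplexTorus d) :=
  {z | z ∈ complexFermi d lam ∧
    ∀ j, ∃ k : ℤ, z j = (((k : ℂ) * (π : ℂ) : ℂ) : AddCircle (2 * (π : ℂ)))}

/-- `reg M_λ^ℂ = M_λ^ℂ \ sng M_λ^ℂ`. -/
def regFermi (d : ℕ) (lam : ℝ) : Set (ComplexTorus d) :=
  complexFermi d lam \ sngFermi d lam

/-! ### Test functions and distributions on the torus -/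

/-- `g ∈ C^∞(Ω)` for an open set `Ω ⊆ 𝕋^d`, read through the covering `ℝ^d → 𝕋^d`. -/
def SmoothFunOn {d : ℕ} (g : Torus d → ℂ) (Ω : Set (Torus d)) : Prop :=
  ContDiffOn ℝ ∞ (fun x : Fin d → ℝ => g (proj x)) (proj ⁻¹' Ω)

/-- The algebra `C^∞(𝕋^d)` of test functions. -/
def TestFun (d : ℕ) : Subalgebra ℂ (Torus d → ℂ) where
  carrier := {φ | ContDiff ℝ ∞ (fun x : Fin d → ℝ => φ (proj x))}
  mul_mem' {a b} ha hb := by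
    simp only [Set.mem_ofPred_eq] at ha hb ⊢
    exact ha.mul hb
  add_mem' {a b} ha hb := by
    simp only [Set.mem_ofPred_eq] at ha hb ⊢
    exact ha.add hb
  algebraMap_mem' c := by
    simp only [Set.mem_ofPred_eq]
    exact contDiff_const (c := c)

/-- The test function `h - λ`. -/
def symbolSub (d : ℕ) (lam : ℝ) : TestFun d :=
  ⟨fun x => ((symbol x - lam : ℝ) : ℂ), by
    have h : ContDiff ℝ ∞ (fun x : Fin d → ℝ =>
        (1 / 2) * ((d : ℝ) - ∑ j, Real.cos (x j)) - lam) := by fun_prop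
    exact Complex.ofRealCLM.contDiff.comp h⟩

/-- A distribution `u ∈ 𝒟'(𝕋^d)`: a linear functional on `C^∞(𝕋^d)` which is continuous, that is,
bounded by a constant times the maximum of the sup norms of the derivatives up to some order. -/
structure Distr (d : ℕ) where
  toLinearMap : TestFun d →ₗ[ℂ] ℂ
  continuous' : ∃ (N : ℕ) (C : ℝ), ∀ (φ : TestFun d) (B : ℝ),
    (∀ k ≤ N, ∀ x : Fin d → ℝ,
      ‖iteratedFDeriv ℝ k (fun y : Fin d → ℝ => (φ : Torus d → ℂ) (proj y)) x‖ ≤ B) →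
    ‖toLinearMap φ‖ ≤ C * B

/-- `u ∈ C^∞(Ω)`: on the open set `Ω` the distribution `u` is given by a smooth function. -/
def Distr.IsSmoothOn {d : ℕ} (u : Distr d) (Ω : Set (Torus d)) : Prop :=
  ∃ g : Torus d → ℂ, SmoothFunOn g Ω ∧
    ∀ φ : TestFun d, tsupport (φ : Torus d → ℂ) ⊆ Ω →
      u.toLinearMap φ = ∫ x, g x * (φ : Torus d → ℂ) x

/-- `a u = f` in `𝒟'(𝕋^d)`, for `a ∈ C^∞(𝕋^d)` and a continuous function `f`. -/
def Distr.MulEq {d : ℕ} (a : TestFun d) (u : Distr d) (f : Torus d → ℂ) : Prop :=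
  ∀ φ : TestFun d, u.toLinearMap (a * φ) = ∫ x, f x * (φ : Torus d → ℂ) x

/-! ### Fourier series -/

/-- The character `e^{i n·x}` on `𝕋^d`. -/
def expi {d : ℕ} (n : Fin d → ℤ) (x : Torus d) : ℂ := ∏ j, fourier (n j) (x j)

theorem expi_proj {d : ℕ} (n : Fin d → ℤ) (x : Fin d → ℝ) :
    expi n (proj x) = Complex.exp (Complex.I * ∑ j, (n j : ℂ) * (x j : ℂ)) := by
  have hpi : (π : ℂ) ≠ 0 := by exact_mod_cast Real.pi_ne_zero
  simp only [expi, proj, fourier_coe_apply, ← Complex.exp_sum, Finset.mul_sum]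
  congr 1
  refine Finset.sum_congr rfl fun j _ => ?_
  push_cast
  field_simp

/-- The normalising constant `(2π)^{-d/2}`. -/
def fourierConst (d : ℕ) : ℂ := (((2 * π) ^ (-(d : ℝ) / 2) : ℝ) : ℂ)

/-- `u = 𝒰 û = (2π)^{-d/2} ∑_n û(n) e^{-i n·x}`, the series converging in `𝒟'(𝕋^d)`. -/
def Distr.IsFourierSeries {d : ℕ} (uhat : (Fin d → ℤ) → ℂ) (u : Distr d) : Prop :=
  ∀ φ : TestFun d,
    HasSum (fun n => fourierConst d * uhat n * ∫ x, expi (-n) x * (φ : Torus d → ℂ) x)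
      (u.toLinearMap φ)

/-- The trigonometric polynomial `(𝒰 f̂)(x) = (2π)^{-d/2} ∑_n f̂(n) e^{-i n·x}` for a finitely
supported sequence `f̂`. -/
def trigPoly {d : ℕ} (fhat : (Fin d → ℤ) → ℂ) (x : Torus d) : ℂ :=
  fourierConst d * ∑ᶠ n, fhat n * expi (-n) x

end

end DiscreteHelmholtz

open DiscreteHelmholtz

/-! The decay condition is used only by duality. Dyadic summation turns it into ∑ |v(n)|² / (1 +
ε²|n|²) ≤ η/ε for every η and all small ε (`VanishingMean`). Cauchy–Schwarz against 1 + ε²|n|² and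
Bessel's inequality then bound |∑ v(n) coeff φ n|² by η/ε times ‖φ‖² + ε²‖∇φ‖², up to constants
(`VanishingMean.norm_tsum_sq_le`). This defines u, and shows that u tends to 0 along test functions
φ_ε whose ε-scaled Sobolev norm squared is O(ε). The equation (h − λ)u = f is summation by parts.

Such test functions come from cut-offs at scale ε around the Fermi surface. Since ∂_j h = sin x_j /
2, the weight W = ∑ sin² x_j + (h − λ)² vanishes exactly at the real singular points, and
integrating the x_j-derivative of sin x_j · arctan((h − λ)/ε) gives ∫ W ε²/((h − λ)² + ε²) = O(ε).
So u(φ k_ε(h − λ)) → 0 whenever |φ|² and |∂_jφ|² are O(W) and k_ε is a Lorentzian-type profile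
(`VanishingMean.norm_distr_mul_symbolComp_le`).

Two profiles finish the argument, with s = h − λ. Take k_ε = εs/(s² + ε²) and φ = f̄W: the equation
turns u(φ k_ε) into ∫ |f|² W ε/(s² + ε²). This Poisson integral stays bounded below if f ≠ 0 at a
regular point of the surface (`exists_le_integral_mul_poisson`), so f vanishes there. Consequently g
= f/(h − λ) extends smoothly across the regular part: in the variable e^{i x_j}, f is a Laurent
polynomial vanishing at the root that h − λ has near the point (`exists_eventually_eq_symbol_mul`).
Finally, for φ supported off the singular set, write 1 = s · s/(s² + ε²) + ε²/(s² + ε²). The second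
term contributes o(1), the first tends to ∫ gφ, and so u = g there
(`VanishingMean.distr_eq_integral`). -/

namespace DiscreteHelmholtz

noncomputable section

/-! ### Coordinate translations and derivatives on the torus -/

/-- The point `t e_j` of the torus. -/
def axis {d : ℕ} (j : Fin d) (t : ℝ) : Torus d := Pi.single j (t : AddCircle (2 * π))

variable {d : ℕ}

theorem proj_add (x y : Fin d → ℝ) : proj (x + y) = proj x + proj y := by
  funext j; simp [proj]

theorem proj_single (j : Fin d) (t : ℝ) : proj (Pi.single j t) = axis j t := by
  funext k
  by_cases h : k = j
  · subst h; simp [proj, axis]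
  · simp [proj, axis, h]

theorem axis_zero (j : Fin d) : axis j 0 = 0 := by simp [axis]

theorem axis_two_pi (j : Fin d) : axis j (2 * π) = 0 := by
  simp [axis]

theorem isOpenQuotientMap_proj : IsOpenQuotientMap (proj : (Fin d → ℝ) → Torus d) :=
  IsOpenQuotientMap.piMap fun _ => QuotientAddGroup.isOpenQuotientMap_mk

theorem continuous_proj : Continuous (proj : (Fin d → ℝ) → Torus d) :=
  isOpenQuotientMap_proj.continuous

theorem continuous_axis (j : Fin d) : Continuous (axis j) := by
  have h : axis j = fun t => proj (Pi.single j t) := by funext t; rw [proj_single]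
  rw [h]
  exact continuous_proj.comp (continuous_single (A := fun _ : Fin d => ℝ) j)

theorem continuous_of_lift {X : Type*} [TopologicalSpace X] {g : Torus d → X}
    (h : Continuous fun x => g (proj x)) : Continuous g :=
  isOpenQuotientMap_proj.continuous_comp_iff.mp h

/-- The lift of a function on the torus to `ℝ^d`. -/
def lift (F : Torus d → ℂ) (x : Fin d → ℝ) : ℂ := F (proj x)

theorem TestFun.contDiff (φ : TestFun d) : ContDiff ℝ ∞ (lift (φ : Torus d → ℂ)) := φ.2

theorem TestFun.continuous (φ : TestFun d) : Continuous (φ : Torus d → ℂ) :=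
  continuous_of_lift (TestFun.contDiff φ).continuous

/-- The partial derivative `∂_j` of a function on the torus. -/
def partialDeriv (j : Fin d) (F : Torus d → ℂ) (x : Torus d) : ℂ :=
  deriv (fun t : ℝ => F (x + axis j t)) 0

theorem hasDerivAt_lift_line {F : Torus d → ℂ} (hF : ContDiff ℝ ∞ (lift F))
    (j : Fin d) (x : Fin d → ℝ) (t : ℝ) :
    HasDerivAt (fun t : ℝ => F (proj x + axis j t))
      (fderiv ℝ (lift F) (x + Pi.single j t) (Pi.single j 1)) t := by
  have h1 : HasDerivAt (fun t : ℝ => x + (Pi.single j t : Fin d → ℝ)) (Pi.single j 1) t := by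
    have := (ContinuousLinearMap.single ℝ (fun _ : Fin d => ℝ) j).hasDerivAt (x := t)
    simpa using this.const_add x
  have h2 := (hF.differentiable (by simp) (x + Pi.single j t)).hasFDerivAt.comp_hasDerivAt t h1
  refine h2.congr_of_eventuallyEq (Eventually.of_forall fun s => ?_)
  simp [lift, proj_add, proj_single]

theorem partialDeriv_proj {F : Torus d → ℂ} (hF : ContDiff ℝ ∞ (lift F)) (j : Fin d)
    (x : Fin d → ℝ) : partialDeriv j F (proj x) = fderiv ℝ (lift F) x (Pi.single j 1) := by
  have := (hasDerivAt_lift_line hF j x 0).deriv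
  simpa [partialDeriv] using this

theorem TestFun.hasDerivAt (φ : TestFun d) (j : Fin d) (x : Torus d) (t : ℝ) :
    HasDerivAt (fun t : ℝ => (φ : Torus d → ℂ) (x + axis j t))
      (partialDeriv j φ (x + axis j t)) t := by
  obtain ⟨y, rfl⟩ := isOpenQuotientMap_proj.surjective x
  rw [← proj_single, ← proj_add, partialDeriv_proj (TestFun.contDiff φ)]
  exact hasDerivAt_lift_line (TestFun.contDiff φ) j y t

theorem TestFun.hasDerivAt_zero (φ : TestFun d) (j : Fin d) (x : Torus d) :
    HasDerivAt (fun t : ℝ => (φ : Torus d → ℂ) (x + axis j t)) (partialDeriv j φ x) 0 := by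
  simpa [axis_zero] using (TestFun.hasDerivAt φ j x) 0

theorem TestFun.contDiff_partialDeriv (φ : TestFun d) (j : Fin d) :
    ContDiff ℝ ∞ (lift (partialDeriv j φ)) := by
  have h : lift (partialDeriv j φ) =
      fun x => fderiv ℝ (lift (φ : Torus d → ℂ)) x (Pi.single j 1) := by
    funext x; exact partialDeriv_proj (TestFun.contDiff φ) j x
  rw [h]
  exact ((TestFun.contDiff φ).fderiv_right (m := ∞) (by simp)).clm_apply contDiff_const

theorem TestFun.continuous_partialDeriv (φ : TestFun d) (j : Fin d) :
    Continuous (partialDeriv j φ) :=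
  continuous_of_lift (TestFun.contDiff_partialDeriv φ j).continuous

theorem partialDeriv_mul (φ ψ : TestFun d) (j : Fin d) (x : Torus d) :
    partialDeriv j ((φ * ψ : TestFun d) : Torus d → ℂ) x
      = partialDeriv j φ x * (ψ : Torus d → ℂ) x + (φ : Torus d → ℂ) x * partialDeriv j ψ x := by
  have := ((TestFun.hasDerivAt_zero φ j x).fun_mul (TestFun.hasDerivAt_zero ψ j x)).deriv
  simpa [axis_zero, partialDeriv] using this

theorem TestFun.norm_le_of_iteratedFDeriv_le (φ : TestFun d) {B : ℝ}
    (hB : ∀ x : Fin d → ℝ,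
      ‖iteratedFDeriv ℝ 0 (fun y : Fin d → ℝ => (φ : Torus d → ℂ) (proj y)) x‖ ≤ B)
    (x : Torus d) : ‖(φ : Torus d → ℂ) x‖ ≤ B := by
  obtain ⟨y, rfl⟩ := isOpenQuotientMap_proj.surjective x
  simpa using hB y

theorem TestFun.norm_partialDeriv_le (φ : TestFun d) {B : ℝ}
    (hB : ∀ x : Fin d → ℝ,
      ‖iteratedFDeriv ℝ 1 (fun y : Fin d → ℝ => (φ : Torus d → ℂ) (proj y)) x‖ ≤ B)
    (j : Fin d) (x : Torus d) : ‖partialDeriv j φ x‖ ≤ B := by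
  obtain ⟨y, rfl⟩ := isOpenQuotientMap_proj.surjective x
  rw [partialDeriv_proj (TestFun.contDiff φ)]
  have h := hB y
  rw [norm_iteratedFDeriv_one] at h
  refine ((fderiv ℝ (lift (φ : Torus d → ℂ)) y).le_opNorm _).trans ?_
  rw [Pi.norm_single, norm_one, mul_one]
  exact h

/-! ### Averaging along a coordinate axis -/

theorem integrable_of_continuous {E : Type*} [NormedAddCommGroup E] {F : Torus d → E}
    (hF : Continuous F) : Integrable F :=
  hF.integrable_of_hasCompactSupport (HasCompactSupport.of_compactSpace F)

/-- Fubini plus translation invariance of the measure. A full period makes derivatives integrate to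
zero; a short symmetric interval reduces lower bounds on the torus to one-dimensional ones. -/
theorem integral_intervalIntegral_axis {E : Type*} [NormedAddCommGroup E] [NormedSpace ℝ E]
    [CompleteSpace E] {F : Torus d → E} (hF : Continuous F) (j : Fin d) (a b : ℝ) :
    ∫ x, (∫ t in a..b, F (x + axis j t)) = (b - a) • ∫ x, F x := by
  have hc : Continuous (Function.uncurry fun (x : Torus d) (t : ℝ) => F (x + axis j t)) :=
    hF.comp (continuous_fst.add ((continuous_axis j).comp continuous_snd))
  have hswap : ∫ t in a..b, ∫ x, F (x + axis j t) = ∫ x, ∫ t in a..b, F (x + axis j t) := by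
    refine intervalIntegral_integral_swap ?_
    obtain ⟨C, hC⟩ := isCompact_univ.exists_bound_of_continuousOn hF.continuousOn
    have : IsFiniteMeasure (volume.restrict (Set.uIoc a b)) := ⟨by
      simp [Set.uIoc]⟩
    refine Integrable.of_bound (C := C) ?_ (Eventually.of_forall fun z => hC _ (Set.mem_univ _))
    refine Continuous.aestronglyMeasurable ?_
    exact hc.comp continuous_swap
  rw [← hswap]
  simp only [integral_add_right_eq_self, intervalIntegral.integral_const]

theorem integral_partialDeriv (φ : TestFun d) (j : Fin d) :
    ∫ x, partialDeriv j φ x = 0 := by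
  have h := integral_intervalIntegral_axis (TestFun.continuous_partialDeriv φ j) j 0 (2 * π)
  have h2 : ∀ x : Torus d, ∫ t in (0 : ℝ)..(2 * π), partialDeriv j φ (x + axis j t) = 0 := by
    intro x
    rw [intervalIntegral.integral_eq_sub_of_hasDerivAt (fun t _ => (TestFun.hasDerivAt φ j x t))]
    · simp [axis_zero, axis_two_pi]
    · refine Continuous.intervalIntegrable ?_ _ _
      exact (TestFun.continuous_partialDeriv φ j).comp (continuous_const.add (continuous_axis j))
  simp only [h2, integral_zero, sub_zero] at h
  have hpi : (2 * π : ℝ) ≠ 0 := by positivity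
  exact ((smul_eq_zero.mp h.symm).resolve_left hpi)

/-! ### Characters -/

theorem contDiff_lift_expi (n : Fin d → ℤ) : ContDiff ℝ ∞ (lift (expi n)) := by
  have h : lift (expi n) = fun x : Fin d → ℝ =>
      Complex.exp (Complex.I * ∑ j, (n j : ℂ) * (x j : ℂ)) := by
    funext x; exact expi_proj n x
  rw [h]
  refine ContDiff.cexp (contDiff_const.mul (ContDiff.sum fun j _ => contDiff_const.mul ?_))
  exact Complex.ofRealCLM.contDiff.comp (contDiff_apply ℝ ℝ j)

/-- The character `e^{i n·x}` as a test function. -/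
def expiTest (n : Fin d → ℤ) : TestFun d := ⟨expi n, contDiff_lift_expi n⟩

theorem expiTest_coe (n : Fin d → ℤ) : ((expiTest n : TestFun d) : Torus d → ℂ) = expi n := rfl

theorem expi_add (m n : Fin d → ℤ) (x : Torus d) : expi (m + n) x = expi m x * expi n x := by
  simp [expi, Finset.prod_mul_distrib]

theorem conj_expi (n : Fin d → ℤ) (x : Torus d) :
    (starRingEnd ℂ) (expi n x) = expi (-n) x := by
  simp [expi]

theorem continuous_expi (n : Fin d → ℤ) : Continuous (expi n : Torus d → ℂ) :=
  TestFun.continuous (expiTest n)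

theorem partialDeriv_expi (n : Fin d → ℤ) (j : Fin d) (x : Torus d) :
    partialDeriv j (expi n) x = Complex.I * n j * expi n x := by
  have hline : ∀ t : ℝ, expi n (x + axis j t) = expi n x * Complex.exp (Complex.I * n j * t) := by
    intro t
    obtain ⟨y, rfl⟩ := isOpenQuotientMap_proj.surjective x
    rw [← proj_single, ← proj_add, expi_proj, expi_proj, ← Complex.exp_add]
    congr 1
    have : ∑ k, (n k : ℂ) * (((Pi.single j t : Fin d → ℝ) k : ℝ) : ℂ) = n j * t := by
      rw [Finset.sum_eq_single j]
      · simp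
      · intro k _ hk; simp [hk]
      · simp
    simp only [Pi.add_apply, Complex.ofReal_add, mul_add, Finset.sum_add_distrib, this]
    ring
  have h : HasDerivAt (fun t : ℝ => expi n x * Complex.exp (Complex.I * n j * t))
      (expi n x * (Complex.exp (Complex.I * n j * (0 : ℝ)) * (Complex.I * n j))) 0 := by
    refine HasDerivAt.const_mul _ (HasDerivAt.cexp ?_)
    simpa using (Complex.ofRealCLM.hasDerivAt (x := (0 : ℝ))).const_mul (Complex.I * n j)
  simp only [partialDeriv, hline]
  rw [h.deriv]
  simp; ring

/-- The Fourier integral `∫ e^{-i n·x} F(x) dx`. -/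
def coeff (F : Torus d → ℂ) (n : Fin d → ℤ) : ℂ := ∫ x, expi (-n) x * F x

/-- Integration by parts: the derivative of e^{-i n·x} φ has mean zero. -/
theorem coeff_partialDeriv (φ : TestFun d) (j : Fin d) (n : Fin d → ℤ) :
    coeff (partialDeriv j φ) n = Complex.I * n j * coeff φ n := by
  have h := integral_partialDeriv (expiTest (-n) * φ) j
  simp only [partialDeriv_mul, expiTest_coe, partialDeriv_expi] at h
  rw [integral_add] at h
  · simp only [coeff]
    simp only [mul_assoc, integral_const_mul, Pi.neg_apply, Int.cast_neg] at h ⊢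
    linear_combination h
  · exact integrable_of_continuous ((continuous_const.mul (continuous_expi _)).mul (TestFun.continuous φ))
  · exact integrable_of_continuous ((continuous_expi _).mul (TestFun.continuous_partialDeriv φ j))

theorem volume_torus : (volume : Measure (Torus d)).real Set.univ = (2 * π) ^ d := by
  rw [Measure.real, volume_pi, Measure.pi_univ]
  simp [AddCircle.measure_univ, ENNReal.toReal_ofReal Real.pi_pos.le]

theorem integral_fourier (n : ℤ) :
    ∫ x : AddCircle (2 * π), fourier n x = if n = 0 then ((2 * π : ℝ) : ℂ) else 0 := by
  split_ifs with h
  · subst h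
    simp [Measure.real, AddCircle.measure_univ, Real.pi_pos.le]
  -- Translation by half a wavelength changes the sign of the character but not its integral.
  · have := integral_add_right_eq_self (μ := (volume : Measure (AddCircle (2 * π))))
      (fun x => (fourier n x : ℂ)) (((2 * π / 2 / n : ℝ) : AddCircle (2 * π)))
    have hneg := fun x => fourier_add_half_inv_index (T := 2 * π) h Real.two_pi_pos x
    simp only [hneg, integral_neg] at this
    exact self_eq_neg.mp this.symm

theorem integral_expi (n : Fin d → ℤ) :
    ∫ x : Torus d, expi n x = if n = 0 then (((2 * π) ^ d : ℝ) : ℂ) else 0 := by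
  simp only [expi]
  rw [integral_fintype_prod_volume_eq_prod (f := fun j (x : AddCircle (2 * π)) => fourier (n j) x)]
  simp only [integral_fourier]
  split_ifs with h
  · subst h; simp
  · obtain ⟨j, hj⟩ := Function.ne_iff.mp h
    exact Finset.prod_eq_zero (Finset.mem_univ j) (by simpa using hj)

/-! ### Bessel's inequality and the ε-scaled Sobolev norm -/

/-- The character `e^{i n·x}` as an element of `L²`. -/
def expiLp (n : Fin d → ℤ) : Lp ℂ 2 (volume : Measure (Torus d)) :=
  ContinuousMap.toLp 2 volume ℂ
    ⟨fun x => (((2 * π) ^ d : ℝ) ^ (-(1 / 2) : ℝ) : ℝ) * expi n x,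
      continuous_const.mul (continuous_expi n)⟩

theorem inner_expiLp (n : Fin d → ℤ) (F : C(Torus d, ℂ)) :
    inner ℂ (expiLp n) (ContinuousMap.toLp 2 volume ℂ F)
      = (((2 * π) ^ d : ℝ) ^ (-(1 / 2) : ℝ) : ℝ) * coeff F n := by
  rw [expiLp, ContinuousMap.inner_toLp, coeff, ← integral_const_mul]
  refine integral_congr_ae (Eventually.of_forall fun x => ?_)
  simp only [ContinuousMap.coe_mk, map_mul, Complex.conj_ofReal, conj_expi]
  ring

theorem orthonormal_expiLp : Orthonormal ℂ (expiLp : (Fin d → ℤ) → _) := by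
  classical
  rw [orthonormal_iff_ite]
  intro m n
  conv_lhs => rw [expiLp.eq_def n]
  rw [inner_expiLp, coeff]
  have h : ∀ x : Torus d, expi (-m) x *
      ((((2 * π) ^ d : ℝ) ^ (-(1 / 2) : ℝ) : ℝ) * expi n x)
      = (((2 * π) ^ d : ℝ) ^ (-(1 / 2) : ℝ) : ℝ) * expi (-m + n) x := by
    intro x; rw [expi_add]; ring
  simp only [ContinuousMap.coe_mk, h, integral_const_mul, integral_expi, neg_add_eq_zero]
  split_ifs with hmn
  · rw [← Complex.ofReal_mul, ← Complex.ofReal_mul, ← mul_assoc]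
    have hp : (0 : ℝ) < (2 * π) ^ d := by positivity
    rw [← Real.rpow_add hp]
    have : (-(1 / 2) + -(1 / 2) : ℝ) = -1 := by norm_num
    rw [this, Real.rpow_neg_one, inv_mul_cancel₀ hp.ne', Complex.ofReal_one]
  · simp

theorem bessel {F : Torus d → ℂ} (hF : Continuous F) (s : Finset (Fin d → ℤ)) :
    ∑ n ∈ s, ‖coeff F n‖ ^ 2 ≤ (2 * π) ^ d * ∫ x, ‖F x‖ ^ 2 := by
  have hp : (0 : ℝ) < (2 * π) ^ d := by positivity
  have h := orthonormal_expiLp.sum_inner_products_le (s := s)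
    (ContinuousMap.toLp 2 volume ℂ ⟨F, hF⟩)
  have hn : ‖ContinuousMap.toLp 2 volume ℂ (⟨F, hF⟩ : C(Torus d, ℂ))‖ ^ 2
      = ∫ x, ‖F x‖ ^ 2 := by
    have := inner_self_eq_norm_sq_to_K (𝕜 := ℂ)
      (ContinuousMap.toLp 2 volume ℂ (⟨F, hF⟩ : C(Torus d, ℂ)))
    rw [ContinuousMap.inner_toLp] at this
    have h2 : ∀ x, F x * (starRingEnd ℂ) (F x) = ((‖F x‖ ^ 2 : ℝ) : ℂ) := by
      intro x; rw [Complex.mul_conj, Complex.normSq_eq_norm_sq]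
    simp only [ContinuousMap.coe_mk, h2] at this
    rw [integral_complex_ofReal, ← RCLike.ofReal_pow] at this
    exact Complex.ofReal_injective this.symm
  rw [hn] at h
  have hc : ∀ n, ‖inner ℂ (expiLp n) (ContinuousMap.toLp 2 volume ℂ (⟨F, hF⟩ : C(Torus d, ℂ)))‖ ^ 2
      = ((2 * π) ^ d)⁻¹ * ‖coeff F n‖ ^ 2 := by
    intro n
    rw [inner_expiLp, norm_mul, mul_pow, Complex.norm_real, Real.norm_eq_abs, sq_abs,
      ← Real.rpow_natCast, ← Real.rpow_mul hp.le]
    norm_num [Real.rpow_neg_one]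
  simp only [hc, ← Finset.mul_sum] at h
  rwa [inv_mul_le_iff₀ hp] at h

theorem latticeNorm_sq (n : Fin d → ℤ) : latticeNorm n ^ 2 = ∑ j, (n j : ℝ) ^ 2 :=
  Real.sq_sqrt (Finset.sum_nonneg fun _ _ => sq_nonneg _)

theorem latticeNorm_nonneg (n : Fin d → ℤ) : 0 ≤ latticeNorm n := Real.sqrt_nonneg _

/-- The squared norm in `H¹` with parameter `ε`. -/
def sobolevSq (ε : ℝ) (φ : TestFun d) : ℝ :=
  (2 * π) ^ d * ((∫ x, ‖(φ : Torus d → ℂ) x‖ ^ 2) +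
    ε ^ 2 * ∑ j, ∫ x, ‖partialDeriv j (φ : Torus d → ℂ) x‖ ^ 2)

theorem sobolevSq_nonneg (ε : ℝ) (φ : TestFun d) : 0 ≤ sobolevSq ε φ := by
  unfold sobolevSq
  have := fun j => integral_nonneg (μ := (volume : Measure (Torus d)))
    (f := fun x => ‖partialDeriv j φ x‖ ^ 2) fun x => by positivity
  have h2 := Finset.sum_nonneg fun j (_ : j ∈ Finset.univ) => this j
  have := integral_nonneg (μ := (volume : Measure (Torus d)))
    (f := fun x => ‖(φ : Torus d → ℂ) x‖ ^ 2) fun x => by positivity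
  positivity

/-- Bessel for φ and for each ∂_jφ, whose coefficients carry the factor i n_j; summing over j
produces |n|². -/
theorem sum_weighted_coeff_le (ε : ℝ) (φ : TestFun d) (s : Finset (Fin d → ℤ)) :
    ∑ n ∈ s, (1 + ε ^ 2 * latticeNorm n ^ 2) * ‖coeff φ n‖ ^ 2 ≤ sobolevSq ε φ := by
  have h0 := bessel (TestFun.continuous φ) s
  have h1 := fun j => bessel (TestFun.continuous_partialDeriv φ j) s
  simp only [coeff_partialDeriv] at h1
  have h2 := Finset.sum_le_sum fun j (_ : j ∈ Finset.univ) => h1 j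
  rw [Finset.sum_comm, ← Finset.mul_sum] at h2
  have h3 : ∑ n ∈ s, (1 + ε ^ 2 * latticeNorm n ^ 2) * ‖coeff φ n‖ ^ 2
      = ∑ n ∈ s, ‖coeff φ n‖ ^ 2 +
        ε ^ 2 * ∑ n ∈ s, ∑ j, ‖Complex.I * n j * coeff φ n‖ ^ 2 := by
    rw [Finset.mul_sum, ← Finset.sum_add_distrib]
    refine Finset.sum_congr rfl fun n _ => ?_
    simp only [norm_mul, Complex.norm_I, one_mul, mul_pow, ← Finset.sum_mul, latticeNorm_sq,
      Complex.norm_intCast, sq_abs]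
    ring
  rw [h3, sobolevSq, mul_add]
  have := mul_le_mul_of_nonneg_left h2 (sq_nonneg ε)
  linarith

/-! ### Sequences with vanishing quadratic mean -/

/-- Lorentzian form of the decay condition. -/
def VanishingMean (v : (Fin d → ℤ) → ℂ) : Prop :=
  ∀ η > 0, ∃ ε₀ > 0, ε₀ ≤ 1 ∧ ∀ ε, 0 < ε → ε ≤ ε₀ → ∀ s : Finset (Fin d → ℤ),
    ∑ n ∈ s, ‖v n‖ ^ 2 / (1 + ε ^ 2 * latticeNorm n ^ 2) ≤ η / ε

/-- The term of the least j with y < 2^j suffices: either j = 0, or y ≥ 2^(j-1) and hence y² ≥ 4^j /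
4. -/
theorem inv_one_add_sq_le_sum_dyadic {y : ℝ} {J : ℕ} (hJ : y < 2 ^ J) :
    1 / (1 + y ^ 2) ≤ ∑ j ∈ Finset.range (J + 1), if y < 2 ^ j then 4 / (4 : ℝ) ^ j else 0 := by
  classical
  have hex : ∃ j : ℕ, y < 2 ^ j := ⟨J, hJ⟩
  set k := Nat.find hex with hk
  have hkJ : k ≤ J := Nat.find_min' hex hJ
  have hyk : y < 2 ^ k := Nat.find_spec hex
  have hone : 1 / (1 + y ^ 2) ≤ 4 / (4 : ℝ) ^ k := by
    rcases Nat.eq_zero_or_pos k with h0 | h0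
    · rw [h0, div_le_div_iff₀ (by positivity) (by positivity)]
      nlinarith [sq_nonneg y]
    · obtain ⟨m, hm⟩ : ∃ m, k = m + 1 := ⟨k - 1, by omega⟩
      have hlt : m < Nat.find hex := by omega
      have hym : (2 : ℝ) ^ m ≤ y := not_lt.mp (Nat.find_min hex hlt)
      rw [hm, div_le_div_iff₀ (by positivity) (by positivity), pow_succ]
      have h4 : (4 : ℝ) ^ m = (2 ^ m) ^ 2 := by
        rw [← pow_mul, mul_comm, pow_mul]; norm_num
      have : ((2 : ℝ) ^ m) ^ 2 ≤ y ^ 2 := pow_le_pow_left₀ (by positivity) hym 2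
      rw [h4]; linarith
  refine hone.trans ?_
  have := Finset.single_le_sum (f := fun j : ℕ => if y < 2 ^ j then 4 / (4 : ℝ) ^ j else 0)
    (fun j _ => by split_ifs <;> positivity) (Finset.mem_range.mpr (Nat.lt_succ_of_le hkJ))
  simpa [hyk] using this

/-- The Lorentzian weight is dominated by a sum of indicators of balls of radius 2^j/ε with weights
4/4^j. The linear bound on each ball leaves a convergent geometric series in 2^{-j}. -/
theorem vanishingMean_of_partial_sums {v : (Fin d → ℤ) → ℂ}
    (h : ∀ η > 0, ∃ R₁ : ℝ, ∀ R ≥ R₁, ∀ s : Finset (Fin d → ℤ), (∀ n ∈ s, latticeNorm n < R) →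
      ∑ n ∈ s, ‖v n‖ ^ 2 ≤ η * R) : VanishingMean v := by
  classical
  intro η hη
  -- The 8 pays for the factor 4 in the dyadic weights and the sum 2 of the geometric series.
  obtain ⟨R₁, hR₁⟩ := h (η / 8) (by positivity)
  refine ⟨1 / max R₁ 1, by positivity, ?_, fun ε hε hε0 s => ?_⟩
  · rw [div_le_one (by positivity)]; exact le_max_right _ _
  have hεR : R₁ ≤ 1 / ε := by
    rw [le_div_iff₀ (by positivity)] at hε0
    rw [le_div_iff₀ hε]
    nlinarith [le_max_left R₁ 1]
  obtain ⟨J, hJ⟩ : ∃ J : ℕ, ∀ n ∈ s, ε * latticeNorm n < 2 ^ J := by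
    -- The sum over `s` stands in for the maximum; it bounds each of its nonnegative terms.
    obtain ⟨J, hJ⟩ := pow_unbounded_of_one_lt (∑ n ∈ s, ε * latticeNorm n) (one_lt_two (α := ℝ))
    refine ⟨J, fun n hn => lt_of_le_of_lt ?_ hJ⟩
    exact Finset.single_le_sum (f := fun n => ε * latticeNorm n)
      (fun m _ => mul_nonneg hε.le (latticeNorm_nonneg m)) hn
  have hj : ∀ j : ℕ, ∑ n ∈ s, (if ε * latticeNorm n < 2 ^ j then ‖v n‖ ^ 2 else 0)
      ≤ η / 8 * (2 ^ j / ε) := by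
    intro j
    rw [← Finset.sum_filter]
    refine hR₁ _ (hεR.trans ?_) _ fun n hn => ?_
    · exact div_le_div_of_nonneg_right (one_le_pow₀ one_le_two) hε.le
    · rw [lt_div_iff₀ hε, mul_comm]
      exact (Finset.mem_filter.mp hn).2
  calc ∑ n ∈ s, ‖v n‖ ^ 2 / (1 + ε ^ 2 * latticeNorm n ^ 2)
      ≤ ∑ n ∈ s, ∑ j ∈ Finset.range (J + 1),
          4 / (4 : ℝ) ^ j * (if ε * latticeNorm n < 2 ^ j then ‖v n‖ ^ 2 else 0) := by
        refine Finset.sum_le_sum fun n hn => ?_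
        have := mul_le_mul_of_nonneg_left (inv_one_add_sq_le_sum_dyadic (hJ n hn)) (sq_nonneg ‖v n‖)
        rw [Finset.mul_sum] at this
        refine le_trans (le_of_eq ?_) (this.trans (le_of_eq (Finset.sum_congr rfl fun j _ => ?_)))
        · rw [mul_pow, mul_one_div]
        · split_ifs <;> ring
    _ = ∑ j ∈ Finset.range (J + 1), 4 / (4 : ℝ) ^ j *
          ∑ n ∈ s, (if ε * latticeNorm n < 2 ^ j then ‖v n‖ ^ 2 else 0) := by
        rw [Finset.sum_comm]; simp only [Finset.mul_sum]
    _ ≤ ∑ j ∈ Finset.range (J + 1), 4 / (4 : ℝ) ^ j * (η / 8 * (2 ^ j / ε)) :=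
        Finset.sum_le_sum fun j _ => mul_le_mul_of_nonneg_left (hj j) (by positivity)
    _ = η / (2 * ε) * ∑ j ∈ Finset.range (J + 1), (1 / 2 : ℝ) ^ j := by
        rw [Finset.mul_sum]
        refine Finset.sum_congr rfl fun j _ => ?_
        have h4 : (4 : ℝ) ^ j = 2 ^ j * 2 ^ j := by rw [← mul_pow]; norm_num
        rw [h4, one_div, inv_pow]
        field_simp
        norm_num
    _ ≤ η / (2 * ε) * 2 := by
        refine mul_le_mul_of_nonneg_left ?_ (by positivity)
        exact sum_geometric_two_le _
    _ = η / ε := by field_simp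

theorem vanishingMean_zeroExtension {R₀ : ℝ} {uhat : (Fin d → ℤ) → ℂ}
    (h : DecayCondition R₀ uhat) : VanishingMean (zeroExtension R₀ uhat) := by
  classical
  refine vanishingMean_of_partial_sums fun η hη => ?_
  have h1 := h.eventually (gt_mem_nhds hη)
  obtain ⟨R₁, hR₁⟩ := eventually_atTop.mp (h1.and (eventually_gt_atTop 0))
  refine ⟨R₁, fun R hR s hs => ?_⟩
  obtain ⟨hlt, hpos⟩ := hR₁ R hR
  have hfin : {n : Fin d → ℤ | R₀ < latticeNorm n ∧ latticeNorm n < R}.Finite :=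
    (finite_latticeNorm_lt R).subset fun n hn => hn.2
  rw [finsum_mem_eq_finite_toFinset_sum _ hfin, one_div, inv_mul_lt_iff₀ hpos] at hlt
  refine le_trans ?_ (hlt.le.trans (le_of_eq (mul_comm _ _)))
  have hz : ∀ n, ‖zeroExtension R₀ uhat n‖ ^ 2
      = if R₀ < latticeNorm n then ‖uhat n‖ ^ 2 else 0 := by
    intro n
    by_cases hn : latticeNorm n ≤ R₀
    · simp [zeroExtension, hn, not_lt.mpr hn]
    · simp [zeroExtension, hn, not_le.mp hn]
  simp only [hz]
  rw [← Finset.sum_filter]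
  refine Finset.sum_le_sum_of_subset_of_nonneg (fun n hn => ?_) fun _ _ _ => sq_nonneg _
  rw [Finset.mem_filter] at hn
  exact hfin.mem_toFinset.mpr ⟨hn.2, hs n hn.1⟩

/-! ### The distribution attached to a sequence -/

/-- Cauchy–Schwarz with weight 1 + ε²|n|² on the coefficients and its inverse on v. A Sobolev norm
squared of order ε cancels the 1/ε and leaves an arbitrarily small η. -/
theorem VanishingMean.sum_sq_le {v : (Fin d → ℤ) → ℂ} (hv : VanishingMean v) :
    ∀ η > 0, ∃ ε₀ > 0, ε₀ ≤ 1 ∧ ∀ ε, 0 < ε → ε ≤ ε₀ →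
      ∀ (φ : TestFun d) (s : Finset (Fin d → ℤ)),
      (∑ n ∈ s, ‖v n * coeff φ n‖) ^ 2 ≤ η / ε * sobolevSq ε φ := by
  intro η hη
  obtain ⟨ε₀, h0, h1, h⟩ := hv η hη
  refine ⟨ε₀, h0, h1, fun ε hε hle φ s => ?_⟩
  have hcs := Finset.sum_sq_le_sum_mul_sum_of_sq_le_mul s
    (r := fun n => ‖v n * coeff φ n‖)
    (f := fun n => ‖v n‖ ^ 2 / (1 + ε ^ 2 * latticeNorm n ^ 2))
    (g := fun n => (1 + ε ^ 2 * latticeNorm n ^ 2) * ‖coeff φ n‖ ^ 2)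
    (fun n _ => by positivity) (fun n _ => by positivity) (fun n _ => by
      have : 1 + ε ^ 2 * latticeNorm n ^ 2 ≠ 0 := by positivity
      refine le_of_eq ?_
      rw [norm_mul]; field_simp)
  refine hcs.trans (mul_le_mul (h ε hε hle s) (sum_weighted_coeff_le ε φ s) ?_ (by positivity))
  exact Finset.sum_nonneg fun n _ => by positivity

theorem VanishingMean.summable {v : (Fin d → ℤ) → ℂ} (hv : VanishingMean v) (φ : TestFun d) :
    Summable fun n => v n * coeff φ n := by
  obtain ⟨ε₀, h0, -, h⟩ := hv.sum_sq_le 1 one_pos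
  refine Summable.of_norm (summable_of_sum_le (c := √(1 / ε₀ * sobolevSq ε₀ φ))
    (fun _ => norm_nonneg _) fun s => ?_)
  exact Real.le_sqrt_of_sq_le (h ε₀ h0 le_rfl φ s)

theorem VanishingMean.norm_tsum_sq_le {v : (Fin d → ℤ) → ℂ} (hv : VanishingMean v) :
    ∀ η > 0, ∃ ε₀ > 0, ε₀ ≤ 1 ∧ ∀ ε, 0 < ε → ε ≤ ε₀ → ∀ φ : TestFun d,
      ‖∑' n, v n * coeff φ n‖ ^ 2 ≤ η / ε * sobolevSq ε φ := by
  intro η hη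
  obtain ⟨ε₀, h0, h1, h⟩ := hv.sum_sq_le η hη
  refine ⟨ε₀, h0, h1, fun ε hε hle φ => ?_⟩
  have hK : 0 ≤ η / ε * sobolevSq ε φ :=
    mul_nonneg (by positivity) (sobolevSq_nonneg ε φ)
  have : ‖∑' n, v n * coeff φ n‖ ≤ √(η / ε * sobolevSq ε φ) :=
    (norm_tsum_le_tsum_norm (hv.summable φ).norm).trans
      (Real.tsum_le_of_sum_le (fun _ => norm_nonneg _)
        fun s => Real.le_sqrt_of_sq_le (h ε hε hle φ s))
  calc _ ≤ (√(η / ε * sobolevSq ε φ)) ^ 2 := pow_le_pow_left₀ (norm_nonneg _) this 2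
    _ = _ := Real.sq_sqrt hK

theorem integral_norm_sq_le {F : Torus d → ℂ} {B : ℝ} (hB : ∀ x, ‖F x‖ ≤ B) :
    ∫ x, ‖F x‖ ^ 2 ≤ B ^ 2 * (2 * π) ^ d := by
  have h := norm_integral_le_of_norm_le_const (μ := (volume : Measure (Torus d)))
    (f := fun x => ‖F x‖ ^ 2) (C := B ^ 2) (Eventually.of_forall fun x => by
      rw [Real.norm_of_nonneg (by positivity)]
      exact pow_le_pow_left₀ (norm_nonneg _) (hB x) 2)
  rw [volume_torus] at h
  exact (Real.le_norm_self _).trans h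

theorem sobolevSq_le {φ : TestFun d} {B ε : ℝ} (h0 : ∀ x, ‖(φ : Torus d → ℂ) x‖ ≤ B)
    (h1 : ∀ j x, ‖partialDeriv j (φ : Torus d → ℂ) x‖ ≤ B) :
    sobolevSq ε φ ≤ (2 * π) ^ d * (2 * π) ^ d * (1 + ε ^ 2 * d) * B ^ 2 := by
  have h2 : ∑ j, ∫ x, ‖partialDeriv j (φ : Torus d → ℂ) x‖ ^ 2
      ≤ ∑ _j : Fin d, B ^ 2 * (2 * π) ^ d :=
    Finset.sum_le_sum fun j _ => integral_norm_sq_le (h1 j)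
  rw [Finset.sum_const, Finset.card_univ, Fintype.card_fin, nsmul_eq_mul] at h2
  have h3 := integral_norm_sq_le h0
  have h4 := mul_le_mul_of_nonneg_left h2 (sq_nonneg ε)
  have hp : (0 : ℝ) < (2 * π) ^ d := by positivity
  calc sobolevSq ε φ ≤ (2 * π) ^ d * (B ^ 2 * (2 * π) ^ d +
        ε ^ 2 * (d * (B ^ 2 * (2 * π) ^ d))) :=
        mul_le_mul_of_nonneg_left (add_le_add h3 h4) hp.le
    _ = _ := by ring

theorem coeff_add (φ ψ : TestFun d) (n : Fin d → ℤ) :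
    coeff ((φ + ψ : TestFun d) : Torus d → ℂ) n = coeff φ n + coeff ψ n := by
  simp only [coeff, AddMemClass.coe_add, Pi.add_apply, mul_add]
  exact integral_add (integrable_of_continuous ((continuous_expi _).mul (TestFun.continuous φ)))
    (integrable_of_continuous ((continuous_expi _).mul (TestFun.continuous ψ)))

theorem coeff_smul (c : ℂ) (φ : TestFun d) (n : Fin d → ℤ) :
    coeff ((c • φ : TestFun d) : Torus d → ℂ) n = c * coeff φ n := by
  simp only [coeff, SetLike.val_smul, Pi.smul_apply, smul_eq_mul, ← integral_const_mul]
  exact integral_congr_ae (Eventually.of_forall fun x => by ring)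

theorem coeff_expiTest_mul (m : Fin d → ℤ) (φ : TestFun d) (n : Fin d → ℤ) :
    coeff ((expiTest m * φ : TestFun d) : Torus d → ℂ) n = coeff φ (n - m) := by
  simp only [coeff, MulMemClass.coe_mul, Pi.mul_apply, expiTest_coe, ← mul_assoc, ← expi_add,
    neg_sub]
  refine integral_congr_ae (Eventually.of_forall fun x => ?_)
  simp only [neg_add_eq_sub]

/-- The distribution `(2π)^{-d/2} ∑_n v(n) e^{-i n·x}`. -/
def VanishingMean.distr {v : (Fin d → ℤ) → ℂ} (hv : VanishingMean v) : Distr d where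
  toLinearMap :=
    { toFun := fun φ => fourierConst d * ∑' n, v n * coeff φ n
      map_add' := fun φ ψ => by
        simp only [coeff_add, mul_add]
        rw [(hv.summable φ).tsum_add (hv.summable ψ), mul_add]
      map_smul' := fun c φ => by
        simp only [coeff_smul, mul_left_comm _ c, tsum_mul_left, smul_eq_mul, RingHom.id_apply] }
  continuous' := by
    obtain ⟨ε, h0, -, h⟩ := hv.norm_tsum_sq_le 1 one_pos
    refine ⟨1, ‖fourierConst d‖ * √(1 / ε * ((2 * π) ^ d * (2 * π) ^ d * (1 + ε ^ 2 * d))),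
      fun φ B hB => ?_⟩
    have hb0 := TestFun.norm_le_of_iteratedFDeriv_le φ (hB 0 zero_le_one)
    have hB0 : 0 ≤ B := (norm_nonneg _).trans (hb0 0)
    have h1 := sobolevSq_le (ε := ε) hb0 (TestFun.norm_partialDeriv_le φ (hB 1 le_rfl))
    have h2 := (h ε h0 le_rfl φ).trans (mul_le_mul_of_nonneg_left h1 (by positivity))
    simp only [LinearMap.coe_mk, AddHom.coe_mk, norm_mul]
    rw [mul_assoc]
    refine mul_le_mul_of_nonneg_left ?_ (norm_nonneg _)
    refine (Real.le_sqrt_of_sq_le h2).trans (le_of_eq ?_)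
    rw [← mul_assoc, Real.sqrt_mul (by positivity), Real.sqrt_sq hB0]

theorem VanishingMean.distr_apply {v : (Fin d → ℤ) → ℂ} (hv : VanishingMean v) (φ : TestFun d) :
    hv.distr.toLinearMap φ = fourierConst d * ∑' n, v n * coeff φ n := rfl

theorem VanishingMean.isFourierSeries {v : (Fin d → ℤ) → ℂ} (hv : VanishingMean v) :
    hv.distr.IsFourierSeries v := by
  intro φ
  simp only [mul_assoc]
  exact (hv.summable φ).hasSum.mul_left (fourierConst d)

/-! ### The equation (h − λ)u = f -/

theorem cos_lift_eq (t : AddCircle (2 * π)) :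
    ((Real.cos_periodic.lift t : ℝ) : ℂ) = (fourier 1 t + fourier (-1) t) / 2 := by
  induction t using QuotientAddGroup.induction_on with
  | H t =>
    have hpi : (π : ℂ) ≠ 0 := by exact_mod_cast Real.pi_ne_zero
    change ((Real.cos t : ℝ) : ℂ) = (fourier 1 (t : AddCircle (2 * π)) +
      fourier (-1) (t : AddCircle (2 * π))) / 2
    have h : ∀ n : ℤ, fourier n (t : AddCircle (2 * π)) = Complex.exp (n * t * Complex.I) := by
      intro n
      rw [fourier_coe_apply]
      congr 1
      push_cast
      field_simp
    rw [Complex.ofReal_cos, Complex.cos, h, h]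
    simp

theorem expi_single (j : Fin d) (k : ℤ) (x : Torus d) :
    expi (Pi.single j k) x = fourier k (x j) := by
  rw [expi, Finset.prod_eq_single j]
  · simp
  · intro i _ hi; simp [hi]
  · simp

theorem symbolSub_eq (lam : ℝ) :
    symbolSub d lam = ((d : ℂ) / 2 - lam) • (1 : TestFun d)
      - (1 / 4 : ℂ) • ∑ j, (expiTest (Pi.single j 1) + expiTest (-Pi.single j 1)) := by
  apply Subtype.ext
  funext x
  have h1 : ∀ j : Fin d, ((expiTest (Pi.single j 1) : TestFun d) : Torus d → ℂ) x
      = fourier 1 (x j) := fun j => expi_single j 1 x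
  have h2 : ∀ j : Fin d, ((expiTest (-Pi.single j 1) : TestFun d) : Torus d → ℂ) x
      = fourier (-1) (x j) := fun j => by
    rw [← Pi.single_neg]; exact expi_single j (-1) x
  have h3 : ((symbolSub d lam : TestFun d) : Torus d → ℂ) x = ((symbol x - lam : ℝ) : ℂ) := rfl
  rw [h3]
  simp only [AddSubgroupClass.coe_sub, SetLike.val_smul, OneMemClass.coe_one, Pi.sub_apply,
    Pi.smul_apply, Pi.one_apply, AddSubmonoidClass.coe_finsetSum, AddMemClass.coe_add,
    Finset.sum_apply, Pi.add_apply, h1, h2, smul_eq_mul, symbol]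
  push_cast
  simp only [cos_lift_eq, ← Finset.sum_div]
  ring

theorem finite_support_helmholtz {lam R₀ : ℝ} {uhat : (Fin d → ℤ) → ℂ}
    (h : ∀ n : Fin d → ℤ, R₀ < latticeNorm n → helmholtz lam uhat n = 0) :
    (Function.support (helmholtz lam (zeroExtension R₀ uhat))).Finite := by
  -- Triangle inequality for the Euclidean norm: a step to a neighbour changes |n| by at most 1.
  have key : ∀ (n : Fin d → ℤ) (j : Fin d) (k : ℤ), |k| = 1 →
      latticeNorm n ≤ latticeNorm (n + Pi.single j k) + 1 := by
    intro n j k hk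
    have hnorm : ∀ m : Fin d → ℤ, latticeNorm m
        = ‖(WithLp.toLp 2 (fun i => (m i : ℝ)) : EuclideanSpace ℝ (Fin d))‖ := by
      intro m; simp [latticeNorm, EuclideanSpace.norm_eq]
    have h1 : latticeNorm (Pi.single j k : Fin d → ℤ) = 1 := by
      rw [latticeNorm, Finset.sum_eq_single j]
      · have : (k : ℝ) ^ 2 = 1 := by
          rw [← sq_abs]; rw [← Int.cast_abs, hk]; norm_num
        simp [this]
      · intro i _ hi; simp [hi]
      · simp
    rw [← h1, hnorm, hnorm, hnorm]
    refine le_trans (le_of_eq ?_) (norm_sub_le _ _)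
    congr 1
    ext i; simp
  -- If |n| ≥ R₀ + 2, then n and all its neighbours lie strictly outside the ball of radius R₀,
  -- where the zero extension agrees with the original sequence.
  refine (finite_latticeNorm_lt (R₀ + 2)).subset fun n hn => ?_
  by_contra hlt
  simp only [Set.mem_ofPred_eq, not_lt] at hlt
  apply hn
  have hz : ∀ m : Fin d → ℤ, R₀ < latticeNorm m → zeroExtension R₀ uhat m = uhat m := by
    intro m hm; simp [zeroExtension, not_le.mpr hm]
  have e1 : ∀ j, zeroExtension R₀ uhat (n + Pi.single j 1) = uhat (n + Pi.single j 1) := by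
    intro j
    have := key n j 1 (by norm_num)
    exact hz _ (by linarith)
  have e2 : ∀ j, zeroExtension R₀ uhat (n - Pi.single j 1) = uhat (n - Pi.single j 1) := by
    intro j
    have := key n j (-1) (by norm_num)
    rw [Pi.single_neg, ← sub_eq_add_neg] at this
    exact hz _ (by linarith)
  have hn' : R₀ < latticeNorm n := by linarith
  rw [← h n hn']
  simp only [helmholtz, discreteLaplacian, e1, e2, hz n hn']

theorem trigPoly_eq_sum {fhat : (Fin d → ℤ) → ℂ} (hf : (Function.support fhat).Finite)
    (x : Torus d) :
    trigPoly fhat x = fourierConst d * ∑ n ∈ hf.toFinset, fhat n * expi (-n) x := by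
  rw [trigPoly, finsum_eq_sum_of_support_subset]
  intro n hn
  simp only [Set.Finite.coe_toFinset, Function.mem_support] at hn ⊢
  exact left_ne_zero_of_mul hn

theorem coeff_symbolSub_mul (lam : ℝ) (φ : TestFun d) (n : Fin d → ℤ) :
    coeff ((symbolSub d lam * φ : TestFun d) : Torus d → ℂ) n
      = ((d : ℂ) / 2 - lam) * coeff φ n - (1 / 4 : ℂ) *
        ∑ j, (coeff φ (n - Pi.single j 1) + coeff φ (n + Pi.single j 1)) := by
  let L : TestFun d →ₗ[ℂ] ℂ :=
    { toFun := fun φ => coeff φ n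
      map_add' := fun φ ψ => coeff_add φ ψ n
      map_smul' := fun c φ => coeff_smul c φ n }
  have hL : ∀ ψ : TestFun d, coeff ψ n = L ψ := fun _ => rfl
  have hL1 : ∀ m, L (expiTest m * φ) = coeff φ (n - m) := fun m => coeff_expiTest_mul m φ n
  rw [hL, symbolSub_eq, sub_mul, map_sub, smul_mul_assoc, smul_mul_assoc, map_smul, map_smul,
    one_mul, Finset.sum_mul, map_sum]
  simp only [add_mul, map_add, hL1, smul_eq_mul, sub_neg_eq_add]
  rfl

/-- Multiplication by a character shifts coefficients, so multiplying the test function by h − λ is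
the transpose of the difference operator on v. Both sides are reduced to the same combination of
absolutely convergent shifted series. -/
theorem VanishingMean.mulEq {v : (Fin d → ℤ) → ℂ} (hv : VanishingMean v) {lam : ℝ}
    (hf : (Function.support (helmholtz lam v)).Finite) :
    hv.distr.MulEq (symbolSub d lam) (trigPoly (helmholtz lam v)) := by
  intro φ
  have hshift : ∀ m : Fin d → ℤ, HasSum (fun n => v (n + m) * coeff φ n)
      (∑' n, v n * coeff φ (n - m)) := by
    intro m
    have h1 : Summable fun n => v n * coeff φ (n - m) := by
      have := hv.summable (expiTest m * φ)
      simpa only [coeff_expiTest_mul] using this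
    have h2 := (Equiv.addRight m).hasSum_iff.mpr h1.hasSum
    refine h2.congr_fun fun n => ?_
    simp
  have hshift' : ∀ m : Fin d → ℤ, HasSum (fun n => v n * coeff φ (n - m))
      (∑' n, v n * coeff φ (n - m)) := by
    intro m
    have := hv.summable (expiTest m * φ)
    simp only [coeff_expiTest_mul] at this
    exact this.hasSum
  have hA : HasSum (fun n => v n * coeff ((symbolSub d lam * φ : TestFun d) : Torus d → ℂ) n)
      (((d : ℂ) / 2 - lam) * (∑' n, v n * coeff φ n) - (1 / 4 : ℂ) * ∑ j : Fin d,
        ((∑' n, v n * coeff φ (n - Pi.single j 1)) +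
          ∑' n, v n * coeff φ (n - -Pi.single j 1))) := by
    have := ((hv.summable φ).hasSum.mul_left ((d : ℂ) / 2 - lam)).sub
      ((hasSum_sum fun (j : Fin d) (_ : j ∈ Finset.univ) =>
        (hshift' (Pi.single j 1)).add (hshift' (-Pi.single j 1))).mul_left (1 / 4 : ℂ))
    refine this.congr_fun fun n => ?_
    rw [coeff_symbolSub_mul]
    simp only [sub_neg_eq_add, ← mul_add, ← Finset.mul_sum]
    ring
  have hB : HasSum (fun n => helmholtz lam v n * coeff φ n)
      (((d : ℂ) / 2 - lam) * (∑' n, v n * coeff φ n) - (1 / 4 : ℂ) * ∑ j : Fin d,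
        ((∑' n, v n * coeff φ (n - Pi.single j 1)) +
          ∑' n, v n * coeff φ (n - -Pi.single j 1))) := by
    have := ((hv.summable φ).hasSum.mul_left ((d : ℂ) / 2 - lam)).sub
      ((hasSum_sum fun (j : Fin d) (_ : j ∈ Finset.univ) =>
        (hshift (Pi.single j 1)).add (hshift (-Pi.single j 1))).mul_left (1 / 4 : ℂ))
    refine this.congr_fun fun n => ?_
    simp only [helmholtz, discreteLaplacian, ← sub_eq_add_neg, ← add_mul, ← Finset.sum_mul]
    ring
  rw [hv.distr_apply, hA.tsum_eq, ← hB.tsum_eq]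
  rw [tsum_eq_sum (s := hf.toFinset) (fun n hn => by
    have : helmholtz lam v n = 0 := by simpa using hn
    rw [this, zero_mul])]
  simp only [trigPoly_eq_sum hf, coeff, mul_assoc, Finset.sum_mul, integral_const_mul]
  rw [integral_finsetSum]
  · simp only [integral_const_mul]
  · intro n _
    exact integrable_of_continuous
      (continuous_const.mul ((continuous_expi _).mul (TestFun.continuous φ)))

/-! ### Trigonometric test functions -/

/-- `sin x_j` on the torus. -/
def sinT (j : Fin d) (x : Torus d) : ℝ := Real.sin_periodic.lift (x j)

/-- `cos x_j` on the torus. -/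
def cosT (j : Fin d) (x : Torus d) : ℝ := Real.cos_periodic.lift (x j)

theorem sinT_proj (j : Fin d) (y : Fin d → ℝ) : sinT j (proj y) = Real.sin (y j) := rfl

theorem cosT_proj (j : Fin d) (y : Fin d → ℝ) : cosT j (proj y) = Real.cos (y j) := rfl

theorem proj_add_axis (y : Fin d → ℝ) (j : Fin d) (t : ℝ) :
    proj y + axis j t = proj (y + Pi.single j t) := by
  rw [proj_add, proj_single]

theorem abs_sinT_le_one (j : Fin d) (x : Torus d) : |sinT j x| ≤ 1 := by
  obtain ⟨y, rfl⟩ := isOpenQuotientMap_proj.surjective x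
  exact Real.abs_sin_le_one _

theorem abs_cosT_le_one (j : Fin d) (x : Torus d) : |cosT j x| ≤ 1 := by
  obtain ⟨y, rfl⟩ := isOpenQuotientMap_proj.surjective x
  exact Real.abs_cos_le_one _

theorem hasDerivAt_sinT (j : Fin d) (x : Torus d) (t : ℝ) :
    HasDerivAt (fun t => sinT j (x + axis j t)) (cosT j (x + axis j t)) t := by
  obtain ⟨y, rfl⟩ := isOpenQuotientMap_proj.surjective x
  simp only [proj_add_axis, sinT_proj, cosT_proj, Pi.add_apply, Pi.single_eq_same]
  simpa using ((hasDerivAt_id t).const_add (y j)).sin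

theorem sinT_add_axis_of_ne {i j : Fin d} (h : i ≠ j) (x : Torus d) (t : ℝ) :
    sinT i (x + axis j t) = sinT i x := by
  simp [sinT, axis, h]

theorem hasDerivAt_symbol (j : Fin d) (x : Torus d) (t : ℝ) :
    HasDerivAt (fun t => symbol (x + axis j t)) (sinT j (x + axis j t) / 2) t := by
  obtain ⟨y, rfl⟩ := isOpenQuotientMap_proj.surjective x
  simp only [proj_add_axis, sinT_proj, symbol_proj]
  have h : ∀ i ∈ (Finset.univ : Finset (Fin d)), HasDerivAt
      (fun t : ℝ => Real.cos ((y + Pi.single j t : Fin d → ℝ) i))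
      (if i = j then - Real.sin ((y + Pi.single j t : Fin d → ℝ) i) else 0) t := by
    intro i _
    split_ifs with hij
    · subst hij
      simpa using ((hasDerivAt_id t).const_add (y i)).cos
    · simpa [hij] using hasDerivAt_const t (Real.cos (y i))
  have := ((HasDerivAt.fun_sum h).const_sub (d : ℝ)).const_mul (1 / 2)
  refine this.congr_deriv ?_
  rw [Finset.sum_ite_eq' Finset.univ j, if_pos (Finset.mem_univ j)]
  ring

/-- A real function on the torus with smooth lift, as a test function. -/
def realTest (a : Torus d → ℝ) (ha : ContDiff ℝ ∞ fun y : Fin d → ℝ => a (proj y)) : TestFun d :=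
  ⟨fun x => (a x : ℂ), Complex.ofRealCLM.contDiff.comp ha⟩

theorem realTest_apply (a : Torus d → ℝ) (ha : ContDiff ℝ ∞ fun y : Fin d → ℝ => a (proj y))
    (x : Torus d) : ((realTest a ha : TestFun d) : Torus d → ℂ) x = (a x : ℂ) := rfl

theorem partialDeriv_realTest {a : Torus d → ℝ} {ha : ContDiff ℝ ∞ fun y : Fin d → ℝ => a (proj y)}
    {j : Fin d} {x : Torus d} {a' : ℝ} (h : HasDerivAt (fun t => a (x + axis j t)) a' 0) :
    partialDeriv j (realTest a ha : TestFun d) x = (a' : ℂ) :=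
  h.ofReal_comp.deriv

theorem contDiff_sinT (j : Fin d) : ContDiff ℝ ∞ fun y : Fin d → ℝ => sinT j (proj y) := by
  simp only [sinT_proj]; fun_prop

theorem contDiff_cosT (j : Fin d) : ContDiff ℝ ∞ fun y : Fin d → ℝ => cosT j (proj y) := by
  simp only [cosT_proj]; fun_prop

theorem contDiff_symbol : ContDiff ℝ ∞ fun y : Fin d → ℝ => symbol (proj y) := by
  simp only [symbol_proj]; fun_prop

theorem continuous_sinT (j : Fin d) : Continuous (sinT j) :=
  continuous_of_lift (contDiff_sinT j).continuous

theorem continuous_cosT (j : Fin d) : Continuous (cosT j) :=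
  continuous_of_lift (contDiff_cosT j).continuous

theorem continuous_symbol : Continuous (symbol : Torus d → ℝ) :=
  continuous_of_lift contDiff_symbol.continuous

theorem symbolSub_apply (lam : ℝ) (x : Torus d) :
    ((symbolSub d lam : TestFun d) : Torus d → ℂ) x = ((symbol x - lam : ℝ) : ℂ) := rfl

/-- The test function `k (h - λ)`. -/
def symbolComp (lam : ℝ) (k : ℝ → ℝ) (hk : ContDiff ℝ ∞ k) : TestFun d :=
  realTest (fun x => k (symbol x - lam)) (hk.comp (contDiff_symbol.sub contDiff_const))

theorem symbolComp_apply (lam : ℝ) (k : ℝ → ℝ) (hk : ContDiff ℝ ∞ k) (x : Torus d) :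
    ((symbolComp lam k hk : TestFun d) : Torus d → ℂ) x = (k (symbol x - lam) : ℂ) := rfl

theorem partialDeriv_symbolComp (lam : ℝ) (k : ℝ → ℝ) (hk : ContDiff ℝ ∞ k) (j : Fin d)
    (x : Torus d) : partialDeriv j (symbolComp lam k hk : TestFun d) x
      = ((deriv k (symbol x - lam) * (sinT j x / 2) : ℝ) : ℂ) := by
  refine partialDeriv_realTest ?_
  have h1 := (hasDerivAt_symbol j x 0).sub_const lam
  have h2 : HasDerivAt k (deriv k (symbol (x + axis j 0) - lam)) (symbol (x + axis j 0) - lam) :=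
    (hk.differentiable (by simp) _).hasDerivAt
  simpa [axis_zero, Function.comp_def] using h2.comp 0 h1

/-! ### The weight vanishing on the singular set -/

/-- `∑_j sin² x_j + (h - λ)²`. -/
def sngWeight (lam : ℝ) (x : Torus d) : ℝ := ∑ j, sinT j x ^ 2 + (symbol x - lam) ^ 2

theorem sngWeight_nonneg (lam : ℝ) (x : Torus d) : 0 ≤ sngWeight lam x := by
  unfold sngWeight; positivity

theorem contDiff_sngWeight (lam : ℝ) :
    ContDiff ℝ ∞ fun y : Fin d → ℝ => sngWeight lam (proj y) := by
  simp only [sngWeight]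
  exact (ContDiff.sum fun j _ => (contDiff_sinT j).pow 2).add
    ((contDiff_symbol.sub contDiff_const).pow 2)

theorem continuous_sngWeight (lam : ℝ) : Continuous (sngWeight lam : Torus d → ℝ) :=
  continuous_of_lift (contDiff_sngWeight lam).continuous

theorem sinT_sq_le_sngWeight (lam : ℝ) (j : Fin d) (x : Torus d) :
    sinT j x ^ 2 ≤ sngWeight lam x := by
  have := Finset.single_le_sum (f := fun j => sinT j x ^ 2) (fun i _ => sq_nonneg _)
    (Finset.mem_univ j)
  have h2 := sq_nonneg (symbol x - lam)
  unfold sngWeight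
  linarith

/-! ### Cut-off profiles k at scale ε, with k² and ε²k'² bounded by the Lorentzian -/

/-- The Lorentzian `ε² / (s² + ε²)`. -/
def lorentz (ε s : ℝ) : ℝ := ε ^ 2 / (s ^ 2 + ε ^ 2)

/-- The conjugate kernel `ε s / (s² + ε²)`. -/
def conjLorentz (ε s : ℝ) : ℝ := ε * s / (s ^ 2 + ε ^ 2)

theorem lorentz_nonneg (ε s : ℝ) : 0 ≤ lorentz ε s := by unfold lorentz; positivity

theorem lorentz_le_one (ε s : ℝ) : lorentz ε s ≤ 1 :=
  div_le_one_of_le₀ (by nlinarith [sq_nonneg s]) (by positivity)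

theorem contDiff_div_sq_add_sq {ε : ℝ} (hε : 0 < ε) {k : ℝ → ℝ} (hk : ContDiff ℝ ∞ k) :
    ContDiff ℝ ∞ fun s => k s / (s ^ 2 + ε ^ 2) :=
  hk.div (by fun_prop) fun s => by positivity

theorem contDiff_lorentz {ε : ℝ} (hε : 0 < ε) : ContDiff ℝ ∞ (lorentz ε) :=
  contDiff_div_sq_add_sq hε contDiff_const

theorem contDiff_conjLorentz {ε : ℝ} (hε : 0 < ε) : ContDiff ℝ ∞ (conjLorentz ε) :=
  contDiff_div_sq_add_sq hε (contDiff_const.mul contDiff_id)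

theorem lorentz_sq_le (ε s : ℝ) : lorentz ε s ^ 2 ≤ lorentz ε s := by
  nlinarith [lorentz_nonneg ε s, lorentz_le_one ε s]

theorem conjLorentz_sq_le {ε : ℝ} (hε : 0 < ε) (s : ℝ) :
    conjLorentz ε s ^ 2 ≤ lorentz ε s := by
  rw [conjLorentz, lorentz, div_pow, div_le_div_iff₀ (by positivity) (by positivity)]
  have : 0 ≤ ε ^ 4 * (s ^ 2 + ε ^ 2) := by positivity
  nlinarith

theorem deriv_lorentz_sq_le {ε : ℝ} (hε : 0 < ε) (s : ℝ) :
    ε ^ 2 * deriv (lorentz ε) s ^ 2 ≤ lorentz ε s := by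
  have hne : s ^ 2 + ε ^ 2 ≠ 0 := by positivity
  have h := (hasDerivAt_const s (ε ^ 2)).fun_div (((hasDerivAt_id s).fun_pow 2).add_const (ε ^ 2)) hne
  have h' : deriv (lorentz ε) s = -(2 * ε ^ 2 * s) / (s ^ 2 + ε ^ 2) ^ 2 := by
    have := h.deriv
    unfold lorentz
    simp only [id] at this
    rw [this]; congr 1; push_cast; ring
  refine le_trans ?_ (lorentz_sq_le ε s)
  rw [h', lorentz, div_pow, div_pow, ← mul_div_assoc,
    div_le_div_iff₀ (by positivity) (by positivity)]
  have h1 : 4 * ε ^ 2 * s ^ 2 ≤ (s ^ 2 + ε ^ 2) ^ 2 := by nlinarith [sq_nonneg (s ^ 2 - ε ^ 2)]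
  have h2 : 0 ≤ ε ^ 4 * (s ^ 2 + ε ^ 2) ^ 2 := by positivity
  nlinarith [mul_le_mul_of_nonneg_left h1 h2]

theorem deriv_conjLorentz_sq_le {ε : ℝ} (hε : 0 < ε) (s : ℝ) :
    ε ^ 2 * deriv (conjLorentz ε) s ^ 2 ≤ lorentz ε s := by
  have hne : s ^ 2 + ε ^ 2 ≠ 0 := by positivity
  have h := ((hasDerivAt_id s).const_mul ε).fun_div
    (((hasDerivAt_id s).fun_pow 2).add_const (ε ^ 2)) hne
  have h' : deriv (conjLorentz ε) s = ε * (ε ^ 2 - s ^ 2) / (s ^ 2 + ε ^ 2) ^ 2 := by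
    have := h.deriv
    unfold conjLorentz
    simp only [id] at this
    rw [this]; congr 1; push_cast; ring
  refine le_trans ?_ (lorentz_sq_le ε s)
  rw [h', lorentz, div_pow, div_pow, ← mul_div_assoc,
    div_le_div_iff₀ (by positivity) (by positivity)]
  have h1 : (ε ^ 2 - s ^ 2) ^ 2 ≤ (s ^ 2 + ε ^ 2) ^ 2 := by
    nlinarith [mul_nonneg (sq_nonneg s) (sq_nonneg ε)]
  have h2 : 0 ≤ ε ^ 4 * (s ^ 2 + ε ^ 2) ^ 2 := by positivity
  nlinarith [mul_le_mul_of_nonneg_left h1 h2]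

theorem integral_le_of_le_const {F : Torus d → ℝ} {C : ℝ} (hC : ∀ x, |F x| ≤ C) :
    |∫ x, F x| ≤ C * (2 * π) ^ d := by
  have h := norm_integral_le_of_norm_le_const (μ := (volume : Measure (Torus d)))
    (f := F) (C := C) (Eventually.of_forall hC)
  rwa [volume_torus] at h

theorem continuous_lorentz_symbol {ε : ℝ} (hε : 0 < ε) (lam : ℝ) :
    Continuous fun x : Torus d => lorentz ε (symbol x - lam) :=
  (contDiff_lorentz hε).continuous.comp (continuous_symbol.sub continuous_const)

/-- Integrate ∂_j of sin x_j · arctan((h − λ)/ε), which has mean zero. One term is bounded by π/2;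
the other is the wanted integrand divided by 2ε, because ∂_j h = sin x_j / 2. -/
theorem integral_sinT_sq_mul_lorentz_le {ε : ℝ} (hε : 0 < ε) (lam : ℝ) (j : Fin d) :
    ∫ x, sinT j x ^ 2 * lorentz ε (symbol x - lam) ≤ π * (2 * π) ^ d * ε := by
  have hk : ContDiff ℝ ∞ fun s : ℝ => Real.arctan (s / ε) :=
    Real.contDiff_arctan.comp (contDiff_id.div_const ε)
  have hd : ∀ s, deriv (fun s : ℝ => Real.arctan (s / ε)) s = lorentz ε s / ε := by
    intro s
    have := ((hasDerivAt_id s).div_const ε).arctan.deriv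
    simp only [id] at this
    rw [this, lorentz]
    field_simp
    ring
  have h := integral_partialDeriv (realTest (sinT j) (contDiff_sinT j) * symbolComp lam _ hk) j
  have hs : ∀ x, partialDeriv j ((realTest (sinT j) (contDiff_sinT j) : TestFun d) : Torus d → ℂ) x
      = (cosT j x : ℂ) := fun x => partialDeriv_realTest (by
        simpa [axis_zero] using hasDerivAt_sinT j x 0)
  have hpd : ∀ x, partialDeriv j ((realTest (sinT j) (contDiff_sinT j) *
      symbolComp lam _ hk : TestFun d) : Torus d → ℂ) x =
      ((cosT j x * Real.arctan ((symbol x - lam) / ε) +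
        1 / (2 * ε) * (sinT j x ^ 2 * lorentz ε (symbol x - lam)) : ℝ) : ℂ) := by
    intro x
    rw [partialDeriv_mul, hs, partialDeriv_symbolComp, symbolComp_apply, realTest_apply, hd]
    push_cast
    ring
  simp only [hpd] at h
  rw [integral_complex_ofReal, Complex.ofReal_eq_zero, integral_add, integral_const_mul] at h
  · have hb := integral_le_of_le_const (d := d)
      (F := fun x => cosT j x * Real.arctan ((symbol x - lam) / ε)) (C := π / 2) fun x => by
        rw [abs_mul, ← one_mul (π / 2)]
        refine mul_le_mul (abs_cosT_le_one j x) ?_ (abs_nonneg _) zero_le_one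
        exact abs_le.mpr ⟨(Real.neg_pi_div_two_lt_arctan _).le, (Real.arctan_lt_pi_div_two _).le⟩
    have hb' := (abs_le.mp hb).1
    have h3 : 1 / (2 * ε) * ∫ x, sinT j x ^ 2 * lorentz ε (symbol x - lam)
        ≤ π / 2 * (2 * π) ^ d := by linarith
    rw [one_div, inv_mul_le_iff₀ (by positivity)] at h3
    linarith
  · exact integrable_of_continuous ((continuous_cosT j).mul
      (hk.continuous.comp (continuous_symbol.sub continuous_const)))
  · exact integrable_of_continuous (continuous_const.mul
      (((continuous_sinT j).pow 2).mul (continuous_lorentz_symbol hε lam)))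

/-- The gain of one power of ε that balances the loss 1/ε in the duality estimate. The summand (h −
λ)² of the weight is harmless, since s²ε²/(s² + ε²) ≤ ε for ε ≤ 1. -/
theorem integral_sngWeight_mul_lorentz_le (d : ℕ) (lam : ℝ) :
    ∃ C > 0, ∀ ε, 0 < ε → ε ≤ 1 →
      ∫ x : Torus d, sngWeight lam x * lorentz ε (symbol x - lam) ≤ C * ε := by
  refine ⟨d * (π * (2 * π) ^ d) + (2 * π) ^ d, by positivity, fun ε hε hε1 => ?_⟩
  have hc := continuous_lorentz_symbol (d := d) hε lam
  simp only [sngWeight, add_mul, Finset.sum_mul]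
  have hi : ∀ j ∈ (Finset.univ : Finset (Fin d)),
      Integrable fun x : Torus d => sinT j x ^ 2 * lorentz ε (symbol x - lam) := fun j _ =>
    integrable_of_continuous (((continuous_sinT j).pow 2).mul hc)
  have hi' : Integrable fun x : Torus d =>
      (symbol x - lam) ^ 2 * lorentz ε (symbol x - lam) :=
    integrable_of_continuous (((continuous_symbol.sub continuous_const).pow 2).mul hc)
  rw [integral_add (integrable_finsetSum _ hi) hi', integral_finsetSum _ hi]
  have h1 := Finset.sum_le_sum fun j (_ : j ∈ (Finset.univ : Finset (Fin d))) =>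
    integral_sinT_sq_mul_lorentz_le hε lam j
  rw [Finset.sum_const, Finset.card_univ, Fintype.card_fin, nsmul_eq_mul] at h1
  have h2 := (le_abs_self _).trans (integral_le_of_le_const (d := d)
    (F := fun x => (symbol x - lam) ^ 2 * lorentz ε (symbol x - lam)) (C := ε) fun x => by
      rw [abs_of_nonneg (mul_nonneg (sq_nonneg _) (lorentz_nonneg _ _)), lorentz,
        ← mul_div_assoc, div_le_iff₀ (by positivity)]
      have : 0 ≤ (symbol x - lam) ^ 2 * ε * (1 - ε) + ε ^ 3 := by
        have : 0 ≤ 1 - ε := by linarith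
        positivity
      nlinarith)
  linarith

theorem VanishingMean.norm_distr_le {v : (Fin d → ℤ) → ℂ} (hv : VanishingMean v) (lam : ℝ) {C : ℝ}
    (hC : 0 ≤ C) :
    ∀ η > 0, ∃ ε₀ > 0, ε₀ ≤ 1 ∧ ∀ ε, 0 < ε → ε ≤ ε₀ → ∀ ψ : TestFun d,
      (∀ x, ‖(ψ : Torus d → ℂ) x‖ ^ 2 ≤ C * (sngWeight lam x * lorentz ε (symbol x - lam))) →
      (∀ j x, ε ^ 2 * ‖partialDeriv j (ψ : Torus d → ℂ) x‖ ^ 2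
        ≤ C * (sngWeight lam x * lorentz ε (symbol x - lam))) →
      ‖hv.distr.toLinearMap ψ‖ ≤ η := by
  intro η hη
  obtain ⟨K, hK, hKε⟩ := integral_sngWeight_mul_lorentz_le d lam
  -- All constants other than ε and η are collected in A; the added 1 makes it positive.
  set A : ℝ := ‖fourierConst d‖ ^ 2 * ((2 * π) ^ d * ((1 + d) * (C * K))) + 1 with hA
  have hApos : 0 < A := by positivity
  obtain ⟨ε₀, h0, h1, h⟩ := hv.norm_tsum_sq_le (η ^ 2 / A) (by positivity)
  refine ⟨ε₀, h0, h1, fun ε hε hle ψ hψ hψ' => ?_⟩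
  have hT := h ε hε hle ψ
  have hcq : Integrable fun x : Torus d => C * (sngWeight lam x * lorentz ε (symbol x - lam)) :=
    integrable_of_continuous (continuous_const.mul
      ((continuous_sngWeight lam).mul (continuous_lorentz_symbol hε lam)))
  have hI := mul_le_mul_of_nonneg_left (hKε ε hε (hle.trans h1)) hC
  rw [← integral_const_mul] at hI
  have hS : sobolevSq ε ψ ≤ (2 * π) ^ d * ((1 + d) * (C * K)) * ε := by
    have e1 : ∫ x, ‖(ψ : Torus d → ℂ) x‖ ^ 2 ≤ C * (K * ε) :=
      (integral_mono (integrable_of_continuous ((TestFun.continuous ψ).norm.pow 2)) hcq hψ).trans hI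
    have e2 : ∀ j, ε ^ 2 * ∫ x, ‖partialDeriv j (ψ : Torus d → ℂ) x‖ ^ 2 ≤ C * (K * ε) := by
      intro j
      rw [← integral_const_mul]
      exact (integral_mono (integrable_of_continuous (continuous_const.mul
        ((TestFun.continuous_partialDeriv ψ j).norm.pow 2))) hcq (hψ' j)).trans hI
    have e3 := Finset.sum_le_sum fun j (_ : j ∈ (Finset.univ : Finset (Fin d))) => e2 j
    rw [Finset.sum_const, Finset.card_univ, Fintype.card_fin, nsmul_eq_mul,
      ← Finset.mul_sum] at e3
    have hp : (0 : ℝ) < (2 * π) ^ d := by positivity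
    have := mul_le_mul_of_nonneg_left (add_le_add e1 e3) hp.le
    refine this.trans (le_of_eq ?_)
    ring
  have h2 : ‖hv.distr.toLinearMap ψ‖ ^ 2 ≤ η ^ 2 := by
    rw [hv.distr_apply, norm_mul, mul_pow]
    calc _ ≤ ‖fourierConst d‖ ^ 2 * (η ^ 2 / A / ε * ((2 * π) ^ d * ((1 + d) * (C * K)) * ε)) := by
          refine mul_le_mul_of_nonneg_left (hT.trans ?_) (sq_nonneg _)
          exact mul_le_mul_of_nonneg_left hS (by positivity)
      _ = η ^ 2 / A * (A - 1) := by rw [hA]; field_simp; ring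
      _ ≤ η ^ 2 / A * A := mul_le_mul_of_nonneg_left (by linarith) (by positivity)
      _ = η ^ 2 := by field_simp
  exact (pow_le_pow_iff_left₀ (norm_nonneg _) hη.le two_ne_zero).mp h2

/-- By the product rule, differentiating the profile costs 1/ε, which the ε² in the Sobolev norm
absorbs; |sin x_j / 2| ≤ 1 handles the inner derivative. -/
theorem VanishingMean.norm_distr_mul_symbolComp_le {v : (Fin d → ℤ) → ℂ} (hv : VanishingMean v)
    (lam : ℝ) {C : ℝ} (hC : 0 ≤ C) {φ : TestFun d}
    (hφ : ∀ x, ‖(φ : Torus d → ℂ) x‖ ^ 2 ≤ C * sngWeight lam x)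
    (hφ' : ∀ j x, ‖partialDeriv j (φ : Torus d → ℂ) x‖ ^ 2 ≤ C * sngWeight lam x) :
    ∀ η > 0, ∃ ε₀ > 0, ε₀ ≤ 1 ∧ ∀ ε, 0 < ε → ε ≤ ε₀ → ∀ (k : ℝ → ℝ) (hk : ContDiff ℝ ∞ k),
      (∀ s, k s ^ 2 ≤ lorentz ε s) → (∀ s, ε ^ 2 * deriv k s ^ 2 ≤ lorentz ε s) →
      ‖hv.distr.toLinearMap (φ * symbolComp lam k hk)‖ ≤ η := by
  intro η hη
  -- The 4 comes from (p + q)² ≤ 2p² + 2q², each square contributing at most C times the weighted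
  -- Lorentzian.
  obtain ⟨ε₀, h0, h1, h⟩ := hv.norm_distr_le lam (C := 4 * C) (by positivity) η hη
  refine ⟨ε₀, h0, h1, fun ε hε hle k hk hk1 hk2 => h ε hε hle _ (fun x => ?_) fun j x => ?_⟩
  · have hq := mul_nonneg hC (sngWeight_nonneg lam x)
    rw [MulMemClass.coe_mul, Pi.mul_apply, symbolComp_apply, norm_mul, mul_pow, Complex.norm_real,
      Real.norm_eq_abs, sq_abs]
    have := mul_le_mul (hφ x) (hk1 (symbol x - lam)) (sq_nonneg _) hq
    have h3 := mul_nonneg hq (lorentz_nonneg ε (symbol x - lam))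
    nlinarith
  · have hq := mul_nonneg hC (sngWeight_nonneg lam x)
    have h3 := mul_nonneg hq (lorentz_nonneg ε (symbol x - lam))
    rw [partialDeriv_mul, symbolComp_apply, partialDeriv_symbolComp]
    set a := ‖partialDeriv j (φ : Torus d → ℂ) x‖
    set b := ‖(φ : Torus d → ℂ) x‖
    set s := symbol x - lam
    have ht : ‖partialDeriv j (φ : Torus d → ℂ) x * (k s : ℂ) +
        (φ : Torus d → ℂ) x * ((deriv k s * (sinT j x / 2) : ℝ) : ℂ)‖
        ≤ a * |k s| + b * |deriv k s| := by
      refine (norm_add_le _ _).trans (add_le_add (le_of_eq ?_) ?_)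
      · rw [norm_mul, Complex.norm_real, Real.norm_eq_abs]
      · rw [norm_mul, Complex.norm_real, Real.norm_eq_abs, abs_mul]
        refine mul_le_mul_of_nonneg_left ?_ (norm_nonneg _)
        refine mul_le_of_le_one_right (abs_nonneg _) ?_
        rw [abs_div, abs_two]
        linarith [abs_sinT_le_one j x]
    have ht2 := pow_le_pow_left₀ (norm_nonneg _) ht 2
    have hx1 : a ^ 2 * k s ^ 2 ≤ C * sngWeight lam x * lorentz ε s :=
      mul_le_mul (hφ' j x) (hk1 s) (sq_nonneg _) hq
    have hx2 : b ^ 2 * (ε ^ 2 * deriv k s ^ 2) ≤ C * sngWeight lam x * lorentz ε s :=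
      mul_le_mul (hφ x) (hk2 s) (by positivity) hq
    have hε2 : ε ^ 2 ≤ 1 := pow_le_one₀ hε.le (hle.trans h1)
    have hx3 : ε ^ 2 * (a ^ 2 * k s ^ 2) ≤ C * sngWeight lam x * lorentz ε s :=
      (mul_le_of_le_one_left (by positivity) hε2).trans hx1
    calc _ ≤ ε ^ 2 * (a * |k s| + b * |deriv k s|) ^ 2 :=
          mul_le_mul_of_nonneg_left ht2 (sq_nonneg _)
      _ ≤ ε ^ 2 * (2 * (a ^ 2 * |k s| ^ 2) + 2 * (b ^ 2 * |deriv k s| ^ 2)) :=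
          mul_le_mul_of_nonneg_left (by nlinarith [sq_nonneg (a * |k s| - b * |deriv k s|)])
            (sq_nonneg _)
      _ = 2 * (ε ^ 2 * (a ^ 2 * k s ^ 2)) + 2 * (b ^ 2 * (ε ^ 2 * deriv k s ^ 2)) := by
          rw [sq_abs, sq_abs]; ring
      _ ≤ _ := by linarith

/-! ### Concentration of the Poisson kernel on the Fermi surface -/

theorem exists_norm_le {E : Type*} [NormedAddCommGroup E] {F : Torus d → E} (hF : Continuous F) :
    ∃ B, 0 ≤ B ∧ ∀ x, ‖F x‖ ≤ B := by
  obtain ⟨B, hB⟩ := isCompact_univ.exists_bound_of_continuousOn hF.continuousOn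
  exact ⟨max B 0, le_max_right _ _, fun x => (hB x (Set.mem_univ x)).trans (le_max_left _ _)⟩

/-- As |s| ≤ 1, the hypothesis forces a to have the sign of s and |a| ≥ δ ≥ ε, so arctan(a/ε) is at
least π/4 in absolute value. -/
theorem mul_arctan_div_ge {s a δ ε : ℝ} (hε : 0 < ε) (hεδ : ε ≤ δ) (hs : |s| ≤ 1)
    (h : δ ≤ s * a) : |s| * (π / 4) ≤ s * Real.arctan (a / ε) := by
  have key : ∀ s a : ℝ, 0 < s → s ≤ 1 → δ ≤ s * a → s * (π / 4) ≤ s * Real.arctan (a / ε) := by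
    intro s a h0 h1 h
    refine mul_le_mul_of_nonneg_left ?_ h0.le
    rw [← Real.arctan_one]
    refine Real.arctan_strictMono.monotone ?_
    rw [le_div_iff₀ hε]
    have : 0 < a := by
      by_contra hneg
      nlinarith [mul_nonneg h0.le (neg_nonneg.mpr (not_lt.mp hneg))]
    nlinarith
  rcases lt_trichotomy s 0 with h0 | h0 | h0
  · have := key (-s) (-a) (by linarith) (by rw [abs_of_neg h0] at hs; exact hs) (by linarith)
    rw [abs_of_neg h0]
    rw [neg_div, Real.arctan_neg] at this
    linarith
  · subst h0; simp
  · rw [abs_of_pos h0] at hs ⊢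
    exact key s a h0 hs h

/-- Since ∂_j h ≠ 0 at x₀, h − λ is strictly monotone along the j-th axis there and takes opposite
signs at the two ends. Continuity makes this uniform over nearby parallel segments. Multiplying by
sin x_j at x₀ treats both signs of the derivative at once. -/
theorem exists_line_crossing (lam : ℝ) {F : Torus d → ℝ} (hF : Continuous F) {x₀ : Torus d}
    (hx₀ : symbol x₀ = lam) {j : Fin d} (hj : sinT j x₀ ≠ 0) (hFx : 0 < F x₀) :
    ∃ r > 0, ∃ δ > 0, ∃ U : Set (Torus d), IsOpen U ∧ x₀ ∈ U ∧
      (∀ x ∈ U, ∀ t ∈ Set.Icc (-r) r, F x₀ / 2 ≤ F (x + axis j t) ∧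
        0 ≤ sinT j x₀ * sinT j (x + axis j t)) ∧
      ∀ x ∈ U, δ ≤ sinT j x₀ * (symbol (x + axis j r) - lam) ∧
        δ ≤ sinT j x₀ * -(symbol (x + axis j (-r)) - lam) := by
  set s := sinT j x₀ with hs
  have hs2 : 0 < s * sinT j x₀ := mul_self_pos.mpr hj
  have hcont : Continuous fun z : Torus d × ℝ => z.1 + axis j z.2 :=
    continuous_fst.add ((continuous_axis j).comp continuous_snd)
  have hev : ∀ᶠ y in 𝓝 x₀, F x₀ / 2 < F y ∧ 0 < s * sinT j y :=
    (hF.continuousAt.eventually (lt_mem_nhds (half_lt_self hFx))).and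
      ((continuous_const.mul (continuous_sinT j)).continuousAt.eventually (lt_mem_nhds hs2))
  have hev2 : ∀ᶠ z : Torus d × ℝ in 𝓝 (x₀, 0),
      F x₀ / 2 < F (z.1 + axis j z.2) ∧ 0 < s * sinT j (z.1 + axis j z.2) := by
    have h0 : Tendsto (fun z : Torus d × ℝ => z.1 + axis j z.2) (𝓝 (x₀, 0)) (𝓝 x₀) := by
      simpa [axis_zero] using hcont.tendsto (x₀, (0 : ℝ))
    exact h0.eventually hev
  rw [nhds_prod_eq, eventually_prod_iff] at hev2
  obtain ⟨pa, hpa, pb, hpb, hab⟩ := hev2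
  obtain ⟨r, hr, hrb⟩ := Metric.nhds_basis_closedBall.eventually_iff.mp hpb
  have hrb' : ∀ t ∈ Set.Icc (-r) r, pb t := fun t ht =>
    hrb (by rw [Real.closedBall_eq_Icc]; simpa using ht)
  have hmono : StrictMonoOn (fun t => s * (symbol (x₀ + axis j t) - lam)) (Set.Icc (-r) r) := by
    have hd : ∀ t, HasDerivAt (fun t => s * (symbol (x₀ + axis j t) - lam))
        (s * (sinT j (x₀ + axis j t) / 2)) t := fun t =>
      ((hasDerivAt_symbol j x₀ t).sub_const lam).const_mul s
    refine strictMonoOn_of_deriv_pos (convex_Icc _ _)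
      (fun t _ => (hd t).continuousAt.continuousWithinAt) fun t ht => ?_
    rw [(hd t).deriv]
    have := (hab hpa.self_of_nhds (hrb' t (interior_subset ht))).2
    dsimp only at this
    linarith
  have hm0 : s * (symbol (x₀ + axis j 0) - lam) = 0 := by simp [axis_zero, hx₀]
  have hpos := hmono ⟨by linarith, hr.le⟩ ⟨by linarith, le_rfl⟩ hr
  have hneg := hmono ⟨le_rfl, by linarith⟩ ⟨by linarith, hr.le⟩ (neg_lt_zero.mpr hr)
  simp only [hm0] at hpos hneg
  set δ := min (s * (symbol (x₀ + axis j r) - lam)) (s * -(symbol (x₀ + axis j (-r)) - lam)) / 2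
    with hδ
  have hmin : 0 < min (s * (symbol (x₀ + axis j r) - lam))
      (s * -(symbol (x₀ + axis j (-r)) - lam)) := lt_min hpos (by linarith)
  have hδ0 : 0 < δ := by positivity
  have hc : ∀ t, Continuous fun x : Torus d => symbol (x + axis j t) - lam := fun t =>
    (continuous_symbol.comp (continuous_id.add continuous_const)).sub continuous_const
  have h1 : ∀ᶠ x in 𝓝 x₀, δ < s * (symbol (x + axis j r) - lam) :=
    (continuous_const.mul (hc r)).continuousAt.eventually
      (lt_mem_nhds ((half_lt_self hmin).trans_le (min_le_left _ _)))
  have h2 : ∀ᶠ x in 𝓝 x₀, δ < s * -(symbol (x + axis j (-r)) - lam) :=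
    (continuous_const.mul (hc (-r)).neg).continuousAt.eventually
      (lt_mem_nhds ((half_lt_self hmin).trans_le (min_le_right _ _)))
  obtain ⟨U, hU, hUo, hxU⟩ := eventually_nhds_iff.mp (hpa.and (h1.and h2))
  refine ⟨r, hr, δ, hδ0, U, hUo, hxU, fun x hx t ht => ?_, fun x hx => ?_⟩
  · have := hab (hU x hx).1 (hrb' t ht)
    exact ⟨this.1.le, this.2.le⟩
  · exact ⟨(hU x hx).2.1.le, (hU x hx).2.2.le⟩

/-- Along each short segment crossing the surface, arctan((h − λ)/ε) is a primitive of (sin x_j / 2)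
times the Poisson kernel and jumps by at least π/2, whatever ε is. Averaging over segments bounds
the integral on the torus. -/
theorem exists_le_integral_mul_poisson (lam : ℝ) {F : Torus d → ℝ} (hF : Continuous F)
    (hF0 : ∀ x, 0 ≤ F x) {x₀ : Torus d} (hx₀ : symbol x₀ = lam) {j : Fin d}
    (hj : sinT j x₀ ≠ 0) (hFx : 0 < F x₀) :
    ∃ c > 0, ∃ ε₁ > 0, ∀ ε, 0 < ε → ε ≤ ε₁ →
      c ≤ ∫ x, F x * (ε / ((symbol x - lam) ^ 2 + ε ^ 2)) := by
  obtain ⟨r, hr, δ, hδ, U, hUo, hxU, hU, hUδ⟩ := exists_line_crossing lam hF hx₀ hj hFx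
  set s := sinT j x₀ with hs
  have hs0 : 0 < |s| := abs_pos.mpr hj
  have hs1 : |s| ≤ 1 := abs_sinT_le_one j x₀
  have hvol : 0 < (volume : Measure (Torus d)).real U :=
    ENNReal.toReal_pos (hUo.measure_pos _ ⟨x₀, hxU⟩).ne' (measure_ne_top _ _)
  -- Each end of the segment contributes |s|π/4.
  set c₀ := F x₀ / 2 * (|s| * (π / 2)) with hc₀
  have hc₀0 : 0 < c₀ := by positivity
  refine ⟨c₀ * (volume : Measure (Torus d)).real U / (2 * r), by positivity, δ, hδ,
    fun ε hε hεδ => ?_⟩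
  set G : Torus d → ℝ := fun x => F x * (ε / ((symbol x - lam) ^ 2 + ε ^ 2)) with hG
  have hGc : Continuous G := by
    refine hF.mul (continuous_const.div₀ (((continuous_symbol.sub continuous_const).pow 2).add
      continuous_const) fun x => ?_)
    positivity
  have hG0 : ∀ x, 0 ≤ G x := fun x => mul_nonneg (hF0 x) (by positivity)
  have hline : ∀ x : Torus d, Continuous fun t : ℝ => G (x + axis j t) := fun x =>
    hGc.comp (continuous_const.add (continuous_axis j))
  have hinner : ∀ x ∈ U, c₀ ≤ ∫ t in (-r)..r, G (x + axis j t) := by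
    intro x hx
    -- The factor s sin(x_j)/2 ≤ 1 is inserted to make the integrand an exact derivative; this only
    -- lowers the integral.
    have hd : ∀ t, HasDerivAt
        (fun t => F x₀ / 2 * (s * Real.arctan ((symbol (x + axis j t) - lam) / ε)))
        (F x₀ / 2 * (s * (sinT j (x + axis j t) / 2 *
          (ε / ((symbol (x + axis j t) - lam) ^ 2 + ε ^ 2))))) t := by
      intro t
      have := ((((hasDerivAt_symbol j x t).sub_const lam).div_const ε).arctan.const_mul s).const_mul
        (F x₀ / 2)
      refine this.congr_deriv ?_
      congr 2
      field_simp
      ring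
    have hcd : Continuous fun t => F x₀ / 2 * (s * (sinT j (x + axis j t) / 2 *
          (ε / ((symbol (x + axis j t) - lam) ^ 2 + ε ^ 2)))) := by
      have hl : Continuous fun t : ℝ => x + axis j t := continuous_const.add (continuous_axis j)
      refine continuous_const.mul (continuous_const.mul
        ((((continuous_sinT j).comp hl).div_const 2).mul
        (continuous_const.div₀ ((((continuous_symbol.comp hl).sub continuous_const).pow 2).add
      continuous_const) fun x => ?_)))
      positivity
    have hint := intervalIntegral.integral_eq_sub_of_hasDerivAt (a := -r) (b := r)
      (fun t _ => hd t) (hcd.intervalIntegrable _ _)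
    have hge : ∫ t in (-r)..r, F x₀ / 2 * (s * (sinT j (x + axis j t) / 2 *
          (ε / ((symbol (x + axis j t) - lam) ^ 2 + ε ^ 2))))
        ≤ ∫ t in (-r)..r, G (x + axis j t) := by
      refine intervalIntegral.integral_mono_on (by linarith) (hcd.intervalIntegrable _ _)
        ((hline x).intervalIntegrable _ _) fun t ht => ?_
      obtain ⟨e1, e2⟩ := hU x hx t ht
      have hle : s * sinT j (x + axis j t) / 2 ≤ 1 := by
        have := abs_sinT_le_one j (x + axis j t)
        have h3 := le_abs_self (s * sinT j (x + axis j t))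
        rw [abs_mul] at h3
        have := mul_le_mul hs1 this (abs_nonneg _) zero_le_one
        linarith
      have hp : 0 ≤ ε / ((symbol (x + axis j t) - lam) ^ 2 + ε ^ 2) := by positivity
      calc _ = F x₀ / 2 * (s * sinT j (x + axis j t) / 2) *
            (ε / ((symbol (x + axis j t) - lam) ^ 2 + ε ^ 2)) := by ring
        _ ≤ _ := mul_le_mul_of_nonneg_right
          ((mul_le_of_le_one_right (by positivity) hle).trans e1) hp
    rw [hint] at hge
    refine le_trans ?_ hge
    have a1 := mul_arctan_div_ge hε hεδ hs1 (hUδ x hx).1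
    have a2 := mul_arctan_div_ge hε hεδ hs1 (hUδ x hx).2
    rw [neg_div, Real.arctan_neg] at a2
    rw [hc₀, ← mul_sub]
    refine mul_le_mul_of_nonneg_left ?_ (by positivity)
    linarith
  -- The segment integrals are at least c₀ over U and nonnegative elsewhere, while their total is 2r
  -- times the integral of G.
  have hav := integral_intervalIntegral_axis hGc j (-r) r
  have hGu : Continuous (Function.uncurry fun (x : Torus d) (t : ℝ) => G (x + axis j t)) :=
    hGc.comp (continuous_fst.add ((continuous_axis j).comp continuous_snd))
  have hIc : Continuous fun x => ∫ t in (-r)..r, G (x + axis j t) :=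
    intervalIntegral.continuous_parametric_intervalIntegral_of_continuous' hGu _ _
  have h1 := setIntegral_ge_of_const_le_real hUo.measurableSet (measure_ne_top volume U) hinner
    (integrable_of_continuous hIc).integrableOn
  have h2 := setIntegral_le_integral (s := U) (integrable_of_continuous hIc)
    (Eventually.of_forall fun x => intervalIntegral.integral_nonneg (by linarith)
      fun t _ => hG0 (x + axis j t))
  rw [hav, smul_eq_mul] at h2
  rw [div_le_iff₀ (by positivity)]
  linarith

/-! ### Vanishing on the regular part of the Fermi surface -/

/-- The complex conjugate of a test function. -/
def conjTest (φ : TestFun d) : TestFun d :=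
  ⟨fun x => (starRingEnd ℂ) ((φ : Torus d → ℂ) x),
    Complex.conjCLE.contDiff.comp (TestFun.contDiff φ)⟩

/-- The weight `∑_j sin² x_j + (h - λ)²` as a test function. -/
def weightTest (d : ℕ) (lam : ℝ) : TestFun d := realTest (sngWeight lam) (contDiff_sngWeight lam)

theorem partialDeriv_weightTest (lam : ℝ) (j : Fin d) (x : Torus d) :
    partialDeriv j (weightTest d lam : TestFun d) x
      = ((sinT j x * (2 * cosT j x + (symbol x - lam)) : ℝ) : ℂ) := by
  refine partialDeriv_realTest ?_
  have h : ∀ i ∈ (Finset.univ : Finset (Fin d)), HasDerivAt (fun t => sinT i (x + axis j t) ^ 2)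
      (if i = j then 2 * sinT i x * cosT i x else 0) 0 := by
    intro i _
    split_ifs with hij
    · subst hij
      simpa [axis_zero] using (hasDerivAt_sinT i x 0).fun_pow 2
    · simpa [sinT_add_axis_of_ne hij] using hasDerivAt_const (0 : ℝ) (sinT i x ^ 2)
  have := (HasDerivAt.fun_sum h).fun_add (((hasDerivAt_symbol j x 0).sub_const lam).fun_pow 2)
  refine this.congr_deriv ?_
  rw [Finset.sum_ite_eq' Finset.univ j, if_pos (Finset.mem_univ j)]
  simp only [axis_zero, add_zero]
  push_cast
  ring

/-- The weight W is bounded, so W² = O(W), and ∂_jW is a bounded multiple of sin x_j, so |∂_jW|² =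
O(W). This makes ρW admissible for the cut-off estimate for every test function ρ. -/
theorem exists_bounds_mul_weightTest (lam : ℝ) (ρ : TestFun d) :
    ∃ C, 0 ≤ C ∧
      (∀ x, ‖((ρ * weightTest d lam : TestFun d) : Torus d → ℂ) x‖ ^ 2 ≤ C * sngWeight lam x) ∧
      ∀ j x, ‖partialDeriv j ((ρ * weightTest d lam : TestFun d) : Torus d → ℂ) x‖ ^ 2
        ≤ C * sngWeight lam x := by
  obtain ⟨A, hA0, hA⟩ := exists_norm_le (TestFun.continuous ρ)
  have hA' := fun j => exists_norm_le (TestFun.continuous_partialDeriv ρ j)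
  choose A' hA'0 hA' using hA'
  obtain ⟨Q, hQ0, hQ⟩ := exists_norm_le (continuous_sngWeight (d := d) lam)
  obtain ⟨P, hP0, hP⟩ := exists_norm_le
    ((continuous_symbol (d := d)).sub (continuous_const (y := lam)))
  have hQ' : ∀ x : Torus d, sngWeight lam x ≤ Q := fun x => (Real.le_norm_self _).trans (hQ x)
  have hS0 : 0 ≤ ∑ j, A' j := Finset.sum_nonneg fun j _ => hA'0 j
  have hw : ∀ x, ‖((weightTest d lam : TestFun d) : Torus d → ℂ) x‖ = sngWeight lam x := fun x => by
    rw [weightTest, realTest_apply, Complex.norm_real,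
      Real.norm_of_nonneg (sngWeight_nonneg lam x)]
  refine ⟨A ^ 2 * Q + (2 * (∑ j, A' j) ^ 2 * Q + 2 * A ^ 2 * (2 + P) ^ 2), by positivity,
    fun x => ?_, fun j x => ?_⟩
  · have hq := sngWeight_nonneg lam x
    rw [MulMemClass.coe_mul, Pi.mul_apply, norm_mul, mul_pow, hw]
    have h1 : ‖(ρ : Torus d → ℂ) x‖ ^ 2 ≤ A ^ 2 := pow_le_pow_left₀ (norm_nonneg _) (hA x) 2
    have h2 : sngWeight lam x ^ 2 ≤ Q * sngWeight lam x := by nlinarith [hQ' x]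
    have h3 := mul_le_mul h1 h2 (sq_nonneg _) (sq_nonneg _)
    have : 0 ≤ (2 * (∑ j, A' j) ^ 2 * Q + 2 * A ^ 2 * (2 + P) ^ 2) * sngWeight lam x := by
      positivity
    linarith
  · have hq := sngWeight_nonneg lam x
    rw [partialDeriv_mul, partialDeriv_weightTest]
    have b1 : ‖partialDeriv j (ρ : Torus d → ℂ) x * ((weightTest d lam : TestFun d) :
        Torus d → ℂ) x‖ ≤ (∑ j, A' j) * sngWeight lam x := by
      rw [norm_mul, hw]
      refine mul_le_mul_of_nonneg_right ((hA' j x).trans ?_) hq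
      exact Finset.single_le_sum (f := A') (fun i _ => hA'0 i) (Finset.mem_univ j)
    have b2 : ‖(ρ : Torus d → ℂ) x * ((sinT j x * (2 * cosT j x + (symbol x - lam)) : ℝ) : ℂ)‖
        ≤ A * (2 + P) * |sinT j x| := by
      rw [norm_mul, Complex.norm_real, Real.norm_eq_abs, abs_mul, mul_assoc]
      refine mul_le_mul (hA x) ?_ (by positivity) hA0
      rw [mul_comm]
      refine mul_le_mul_of_nonneg_right ((abs_add_le _ _).trans (add_le_add ?_ (hP x)))
        (abs_nonneg _)
      rw [abs_mul, abs_two]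
      linarith [abs_cosT_le_one j x]
    have b3 := pow_le_pow_left₀ (norm_nonneg _) ((norm_add_le _ _).trans (add_le_add b1 b2)) 2
    refine b3.trans ?_
    have h2 : sngWeight lam x ^ 2 ≤ Q * sngWeight lam x := by nlinarith [hQ' x]
    calc ((∑ j, A' j) * sngWeight lam x + A * (2 + P) * |sinT j x|) ^ 2
        ≤ 2 * ((∑ j, A' j) * sngWeight lam x) ^ 2 + 2 * (A * (2 + P) * |sinT j x|) ^ 2 := by
          nlinarith [sq_nonneg ((∑ j, A' j) * sngWeight lam x - A * (2 + P) * |sinT j x|)]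
      _ = 2 * (∑ j, A' j) ^ 2 * sngWeight lam x ^ 2
          + 2 * A ^ 2 * (2 + P) ^ 2 * sinT j x ^ 2 := by
          rw [mul_pow, mul_pow, sq_abs]; ring
      _ ≤ 2 * (∑ j, A' j) ^ 2 * (Q * sngWeight lam x)
          + 2 * A ^ 2 * (2 + P) ^ 2 * sngWeight lam x :=
          add_le_add (mul_le_mul_of_nonneg_left h2 (by positivity))
            (mul_le_mul_of_nonneg_left (sinT_sq_le_sngWeight lam j x) (by positivity))
      _ ≤ _ := by
          have : 0 ≤ A ^ 2 * Q * sngWeight lam x := by positivity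
          linarith

/-- Test u against f̄ W εs/(s² + ε²) with s = h − λ. The cut-off estimate makes this small, while
the equation identifies it with a Poisson integral of |f|²W, bounded below if f(x₀) ≠ 0. -/
theorem VanishingMean.eq_zero_of_mulEq {v : (Fin d → ℤ) → ℂ} (hv : VanishingMean v) {lam : ℝ}
    {f : TestFun d} (hf : hv.distr.MulEq (symbolSub d lam) f) {x₀ : Torus d}
    (hx₀ : symbol x₀ = lam) {j : Fin d} (hj : sinT j x₀ ≠ 0) : (f : Torus d → ℂ) x₀ = 0 := by
  by_contra hne
  set F : Torus d → ℝ := fun x => ‖(f : Torus d → ℂ) x‖ ^ 2 * sngWeight lam x with hF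
  have hFc : Continuous F := ((TestFun.continuous f).norm.pow 2).mul (continuous_sngWeight lam)
  have hF0 : ∀ x, 0 ≤ F x := fun x => mul_nonneg (sq_nonneg _) (sngWeight_nonneg lam x)
  have hq : 0 < sngWeight lam x₀ :=
    lt_of_lt_of_le (by positivity) (sinT_sq_le_sngWeight lam j x₀)
  have hFx : 0 < F x₀ := mul_pos (by positivity) hq
  obtain ⟨c, hc, ε₁, hε₁, hlow⟩ := exists_le_integral_mul_poisson lam hFc hF0 hx₀ hj hFx
  obtain ⟨C, hC, hb, hb'⟩ := exists_bounds_mul_weightTest lam (conjTest f)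
  obtain ⟨ε₀, hε₀, -, hup⟩ := hv.norm_distr_mul_symbolComp_le lam hC hb hb' (c / 2) (by positivity)
  set ε := min ε₀ ε₁ with hε
  have hεpos : 0 < ε := lt_min hε₀ hε₁
  have h1 := hlow ε hεpos (min_le_right _ _)
  have h2 := hup ε hεpos (min_le_left _ _) (conjLorentz ε) (contDiff_conjLorentz hεpos)
    (conjLorentz_sq_le hεpos) (deriv_conjLorentz_sq_le hεpos)
  have hk : ContDiff ℝ ∞ fun s : ℝ => ε / (s ^ 2 + ε ^ 2) :=
    contDiff_div_sq_add_sq hεpos contDiff_const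
  -- The conjugate kernel is s times the Poisson kernel, so a factor h − λ splits off and the
  -- equation applies.
  have hfac : conjTest f * weightTest d lam * symbolComp lam _ (contDiff_conjLorentz hεpos)
      = symbolSub d lam * (conjTest f * weightTest d lam * symbolComp lam _ hk) := by
    apply Subtype.ext
    funext x
    simp only [MulMemClass.coe_mul, Pi.mul_apply, symbolComp_apply, symbolSub_apply, conjLorentz]
    push_cast
    ring
  rw [hfac, hf] at h2
  have hint : ∀ x, (f : Torus d → ℂ) x *
      ((conjTest f * weightTest d lam * symbolComp lam _ hk : TestFun d) : Torus d → ℂ) x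
      = ((F x * (ε / ((symbol x - lam) ^ 2 + ε ^ 2)) : ℝ) : ℂ) := by
    intro x
    simp only [MulMemClass.coe_mul, Pi.mul_apply, symbolComp_apply]
    have h3 : ((conjTest f : TestFun d) : Torus d → ℂ) x
      = (starRingEnd ℂ) ((f : Torus d → ℂ) x) := rfl
    rw [h3, weightTest, realTest_apply, ← mul_assoc, ← mul_assoc, Complex.mul_conj,
      Complex.normSq_eq_norm_sq, ← Complex.ofReal_mul, ← Complex.ofReal_mul]
  simp only [hint] at h2
  rw [integral_complex_ofReal, Complex.norm_real] at h2
  have := (Real.le_norm_self _).trans h2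
  linarith

/-! ### Division by the symbol -/

theorem contDiffAt_complex_div {E : Type*} [NormedAddCommGroup E] [NormedSpace ℝ E] {f g : E → ℂ}
    {x : E} (hf : ContDiffAt ℝ ∞ f x) (hg : ContDiffAt ℝ ∞ g x) (hx : g x ≠ 0) :
    ContDiffAt ℝ ∞ (fun y => f y / g y) x := by
  simp only [div_eq_mul_inv]
  exact hf.mul (hg.inv hx)

/-- The divided difference of z^m is a polynomial for m ≥ 0. For m = −n it is minus the divided
difference of z^n over z^n w^n, smooth away from zero. -/
theorem exists_zpow_sub_zpow_eq_mul (m : ℤ) :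
    ∃ D : ℂ × ℂ → ℂ, ∀ z w : ℂ, z ≠ 0 → w ≠ 0 →
      z ^ m - w ^ m = (z - w) * D (z, w) ∧ ContDiffAt ℝ ∞ D (z, w) := by
  have hnat : ∀ n : ℕ, ContDiff ℝ ∞ fun p : ℂ × ℂ =>
      ∑ i ∈ Finset.range n, p.1 ^ i * p.2 ^ (n - 1 - i) := fun n => by fun_prop
  obtain ⟨n, rfl | rfl⟩ := m.eq_nat_or_neg
  · refine ⟨_, fun z w _ _ => ⟨?_, (hnat n).contDiffAt⟩⟩
    simp only [zpow_natCast]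
    rw [mul_comm]
    exact (geom_sum₂_mul z w n).symm
  · refine ⟨fun p => -(∑ i ∈ Finset.range n, p.1 ^ i * p.2 ^ (n - 1 - i)) / (p.1 ^ n * p.2 ^ n),
      fun z w hz hw => ⟨?_, ?_⟩⟩
    · have h := geom_sum₂_mul z w n
      have hz' := pow_ne_zero n hz
      have hw' := pow_ne_zero n hw
      simp only [zpow_neg, zpow_natCast]
      rw [mul_div_assoc', eq_div_iff (mul_ne_zero hz' hw'), mul_neg, mul_comm (z - w), h]
      field_simp
      ring
    · have hden : ContDiff ℝ ∞ fun p : ℂ × ℂ => p.1 ^ n * p.2 ^ n := by fun_prop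
      refine contDiffAt_complex_div (hnat n).contDiffAt.neg hden.contDiffAt ?_
      exact mul_ne_zero (pow_ne_zero n hz) (pow_ne_zero n hw)

theorem expi_proj_eq_mul (n : Fin d → ℤ) (j : Fin d) (x : Fin d → ℝ) :
    expi n (proj x) = Complex.exp (x j * Complex.I) ^ n j *
      ∏ k ∈ Finset.univ.erase j, Complex.exp (n k * (x k * Complex.I)) := by
  have h : ∀ k, fourier (n k) (proj x k) = Complex.exp (n k * (x k * Complex.I)) := by
    intro k
    rw [proj, fourier_coe_apply]
    congr 1
    push_cast
    field_simp
  simp only [expi, h]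
  rw [← Finset.mul_prod_erase _ _ (Finset.mem_univ j), Complex.exp_int_mul]

/-- With z = e^{i x_j}, the equation h = λ is quadratic in z, with roots E and 1/E depending
smoothly on the other coordinates. Near x₀ only E is close to z; as f vanishes at z = E, both f and
h − λ carry the factor z − E, and it cancels. -/
theorem exists_eventually_eq_symbol_mul {fhat : (Fin d → ℤ) → ℂ} {lam : ℝ}
    (hfin : (Function.support fhat).Finite)
    {j : Fin d} (hvan : ∀ x : Torus d, symbol x = lam → sinT j x ≠ 0 → trigPoly fhat x = 0)
    {x₀ : Fin d → ℝ} (hx₀ : symbol (proj x₀) = lam) (hj : sinT j (proj x₀) ≠ 0) :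
    ∃ Q : (Fin d → ℝ) → ℂ, ContDiffAt ℝ ∞ Q x₀ ∧
      ∀ᶠ x in 𝓝 x₀, trigPoly fhat (proj x) = ((symbol (proj x) - lam : ℝ) : ℂ) * Q x := by
  classical
  rw [sinT_proj] at hj
  -- The surface is cos x_j = a(x), where a does not depend on x_j.
  set a : (Fin d → ℝ) → ℝ := fun x => d - 2 * lam - ∑ k ∈ Finset.univ.erase j, Real.cos (x k)
    with ha
  have hac : ContDiff ℝ ∞ a := by
    refine contDiff_const.sub (ContDiff.sum fun k _ => ?_)
    exact Real.contDiff_cos.comp (contDiff_apply ℝ ℝ k)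
  have hsym : ∀ x, symbol (proj x) - lam = (a x - Real.cos (x j)) / 2 := by
    intro x
    rw [symbol_proj, ← Finset.add_sum_erase _ _ (Finset.mem_univ j), ha]
    ring
  have ha0 : a x₀ = Real.cos (x₀ j) := by
    have := hsym x₀
    rw [hx₀] at this
    linarith
  have hpos0 : 0 < 1 - a x₀ ^ 2 := by
    rw [ha0, ← Real.sin_sq]; positivity
  -- The sign σ selects the branch of the square root that equals sin x_j at x₀.
  obtain ⟨σ, hσ, hσs⟩ : ∃ σ : ℝ, σ ^ 2 = 1 ∧ σ * √(1 - a x₀ ^ 2) = Real.sin (x₀ j) := by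
    have hsq : √(1 - a x₀ ^ 2) = |Real.sin (x₀ j)| := by
      rw [ha0, ← Real.sin_sq, Real.sqrt_sq_eq_abs]
    rcases lt_or_gt_of_ne hj with h | h
    · exact ⟨-1, by norm_num, by rw [hsq, abs_of_neg h]; ring⟩
    · exact ⟨1, by norm_num, by rw [hsq, abs_of_pos h]; ring⟩
  set E : (Fin d → ℝ) → ℂ := fun x => (a x : ℂ) + ((σ * √(1 - a x ^ 2) : ℝ) : ℂ) * Complex.I
    with hE
  set z : (Fin d → ℝ) → ℂ := fun x => Complex.exp (x j * Complex.I) with hz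
  have hz0 : ∀ x, z x ≠ 0 := fun x => Complex.exp_ne_zero _
  have hzc : ContDiff ℝ ∞ z :=
    ((Complex.ofRealCLM.contDiff.comp (contDiff_apply ℝ ℝ j)).mul contDiff_const).cexp
  have hE0 : E x₀ = z x₀ := by
    simp only [hE, hz]
    rw [hσs, ha0, Complex.exp_mul_I, Complex.ofReal_cos, Complex.ofReal_sin]
  have hEc : ContDiffAt ℝ ∞ E x₀ := by
    refine (Complex.ofRealCLM.contDiff.contDiffAt.comp x₀ hac.contDiffAt).add
      (ContDiffAt.mul (Complex.ofRealCLM.contDiff.contDiffAt.comp x₀ (contDiffAt_const.mul ?_))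
        contDiffAt_const)
    exact (contDiffAt_const.sub (hac.contDiffAt.pow 2)).sqrt hpos0.ne'
  have hEne0 : E x₀ ≠ 0 := hE0 ▸ hz0 x₀
  -- The two roots are distinct at x₀: if E = 1/z there, then z² = 1 and sin x_j = 0.
  have hden0 : 1 - (E x₀ * z x₀)⁻¹ ≠ 0 := by
    rw [hE0, sub_ne_zero]
    intro h
    have h1 : z x₀ * z x₀ = 1 := inv_eq_one.mp h.symm
    have h2 : z x₀ = (Real.cos (x₀ j) : ℂ) + (Real.sin (x₀ j) : ℂ) * Complex.I := by
      simp only [hz]; rw [Complex.exp_mul_I, Complex.ofReal_cos, Complex.ofReal_sin]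
    have hre := congrArg Complex.re h1
    have him := congrArg Complex.im h1
    rw [h2] at hre him
    simp only [Complex.mul_re, Complex.mul_im, Complex.add_re, Complex.add_im, Complex.ofReal_re,
      Complex.ofReal_im, Complex.I_re, Complex.I_im, Complex.one_re] at hre
    have h3 := Real.sin_sq_add_cos_sq (x₀ j)
    have h4 : Real.sin (x₀ j) ^ 2 = 0 := by nlinarith
    exact hj (by simpa using h4)
  choose D hD using exists_zpow_sub_zpow_eq_mul
  set Cn : (Fin d → ℤ) → (Fin d → ℝ) → ℂ := fun n x => fourierConst d * (fhat n *
    ∏ k ∈ Finset.univ.erase j, Complex.exp ((-n) k * (x k * Complex.I))) with hCn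
  have hCc : ∀ n, ContDiff ℝ ∞ (Cn n) := by
    intro n
    refine contDiff_const.mul (contDiff_const.mul (contDiff_prod fun k _ => ?_))
    exact (contDiff_const.mul
      ((Complex.ofRealCLM.contDiff.comp (contDiff_apply ℝ ℝ k)).mul contDiff_const)).cexp
  have htrig : ∀ x, trigPoly fhat (proj x) = ∑ n ∈ hfin.toFinset, Cn n x * z x ^ (-n) j := by
    intro x
    rw [trigPoly_eq_sum hfin, Finset.mul_sum]
    refine Finset.sum_congr rfl fun n _ => ?_
    rw [expi_proj_eq_mul _ j, hCn, hz]
    ring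
  refine ⟨fun x => -4 * (∑ n ∈ hfin.toFinset, Cn n x * D ((-n) j) (z x, E x)) /
    (1 - (E x * z x)⁻¹), ?_, ?_⟩
  · have hdenc : ContDiffAt ℝ ∞ (fun x => 1 - (E x * z x)⁻¹) x₀ :=
      contDiffAt_const.sub (ContDiffAt.inv (𝕜 := ℝ) (hEc.mul hzc.contDiffAt)
        (mul_ne_zero hEne0 (hz0 _)))
    refine contDiffAt_complex_div (contDiffAt_const.mul (ContDiffAt.sum fun n _ => ?_)) hdenc hden0
    exact (hCc n).contDiffAt.mul ((hD _ _ _ (hz0 x₀) hEne0).2.comp x₀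
      (hzc.contDiffAt.prodMk hEc))
  · have hcE := hEc.continuousAt
    have hden : ContinuousAt (fun x => 1 - (E x * z x)⁻¹) x₀ :=
      continuousAt_const.sub ((hcE.mul hzc.continuous.continuousAt).inv₀
        (mul_ne_zero hEne0 (hz0 _)))
    have hposc : ContinuousAt (fun x => 1 - a x ^ 2) x₀ :=
      (continuous_const.sub (hac.continuous.pow 2)).continuousAt
    filter_upwards [hcE.eventually_ne hEne0, hden.eventually_ne hden0,
      hposc.eventually (lt_mem_nhds hpos0)] with x hEx hdx hpx
    have hsq : (σ * √(1 - a x ^ 2)) ^ 2 = 1 - a x ^ 2 := by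
      rw [mul_pow, hσ, one_mul, Real.sq_sqrt hpx.le]
    have hEnorm : ‖E x‖ = 1 := by
      have : ‖E x‖ ^ 2 = 1 := by
        rw [← Complex.normSq_eq_norm_sq, hE, Complex.normSq_add_mul_I, hsq]; ring
      exact (pow_eq_one_iff_of_nonneg (norm_nonneg _) two_ne_zero).mp this
    have hEarg : Complex.exp (Complex.arg (E x) * Complex.I) = E x := by
      have := Complex.norm_mul_exp_arg_mul_I (E x)
      rwa [hEnorm, Complex.ofReal_one, one_mul] at this
    have hre : Real.cos (Complex.arg (E x)) = a x := by
      have := congrArg Complex.re hEarg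
      rw [Complex.exp_ofReal_mul_I_re] at this
      rw [this, hE]; simp
    have him : Real.sin (Complex.arg (E x)) = σ * √(1 - a x ^ 2) := by
      have := congrArg Complex.im hEarg
      rw [Complex.exp_ofReal_mul_I_im] at this
      rw [this, hE]; simp
    -- The point of the surface on the line through x in direction j: there z equals E, and the
    -- coefficients Cn are unchanged.
    set y : Fin d → ℝ := Function.update x j (Complex.arg (E x)) with hy
    have hyk : ∀ k ∈ Finset.univ.erase j, y k = x k := fun k hk => by
      rw [hy, Function.update_of_ne (Finset.ne_of_mem_erase hk)]
    have hyj : y j = Complex.arg (E x) := by rw [hy, Function.update_self]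
    have hay : a y = a x := by
      simp only [ha]
      congr 1
      exact Finset.sum_congr rfl fun k hk => by rw [hyk k hk]
    have hfy : trigPoly fhat (proj y) = 0 := by
      refine hvan _ ?_ ?_
      · have := hsym y
        rw [hay, hyj, hre] at this
        linarith
      · rw [sinT_proj, hyj, him]
        intro h0
        rw [h0] at hsq
        linarith
    have hzy : z y = E x := by simp only [hz]; rw [hyj, hEarg]
    have hCy : ∀ n, Cn n y = Cn n x := by
      intro n
      simp only [hCn]
      congr 2
      exact Finset.prod_congr rfl fun k hk => by rw [hyk k hk]
    rw [htrig] at hfy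
    simp only [hCy, hzy] at hfy
    have hf : trigPoly fhat (proj x)
        = (z x - E x) * ∑ n ∈ hfin.toFinset, Cn n x * D ((-n) j) (z x, E x) := by
      rw [htrig, ← sub_zero (∑ n ∈ hfin.toFinset, _), ← hfy, ← Finset.sum_sub_distrib,
        Finset.mul_sum]
      refine Finset.sum_congr rfl fun n _ => ?_
      rw [← mul_sub, (hD _ _ _ (hz0 x) hEx).1]
      ring
    have haE : (a x : ℂ) = (E x + (E x)⁻¹) / 2 := by
      rw [← hre, Complex.ofReal_cos, Complex.cos, neg_mul, Complex.exp_neg, hEarg]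
    have hcz : ((Real.cos (x j) : ℝ) : ℂ) = (z x + (z x)⁻¹) / 2 := by
      rw [Complex.ofReal_cos, Complex.cos, neg_mul, Complex.exp_neg]
    have hp : ((symbol (proj x) - lam : ℝ) : ℂ)
        = (E x - z x) * (1 - (E x * z x)⁻¹) / 4 := by
      rw [hsym]
      push_cast
      rw [haE, ← Complex.ofReal_cos, hcz]
      have := hz0 x
      field_simp
      ring
    rw [hf, hp]
    generalize ∑ n ∈ hfin.toFinset, Cn n x * D ((-n) j) (z x, E x) = S
    generalize 1 - (E x * z x)⁻¹ = w at hdx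
    field_simp
    ring

open Classical in
/-- The quotient `f / (h - λ)`, extended to the regular part of the Fermi surface by the ratio of
the derivatives in a transversal direction. -/
def symbolQuotient (lam : ℝ) (f : Torus d → ℂ) (x : Torus d) : ℂ :=
  if symbol x = lam then
    if h : ∃ j, sinT j x ≠ 0 then partialDeriv h.choose f x / ((sinT h.choose x / 2 : ℝ) : ℂ) else 0
  else f x / ((symbol x - lam : ℝ) : ℂ)

/-- Differentiating f = (h − λ)Q at a point of the surface along any axis i with sin x_i ≠ 0 gives Q
= ∂_i f / (sin x_i / 2). So the chosen axis is immaterial and the pointwise formula inherits the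
smoothness of Q. -/
theorem symbolQuotient_eventuallyEq {lam : ℝ} {f : Torus d → ℂ} {x₀ : Fin d → ℝ} {j : Fin d}
    (hj : sinT j (proj x₀) ≠ 0) {Q : (Fin d → ℝ) → ℂ} (hQ : ContDiffAt ℝ ∞ Q x₀)
    (hf : ∀ᶠ x in 𝓝 x₀, f (proj x) = ((symbol (proj x) - lam : ℝ) : ℂ) * Q x) :
    (fun x => symbolQuotient lam f (proj x)) =ᶠ[𝓝 x₀] Q := by
  have hQ1 : ∀ᶠ x in 𝓝 x₀, ContDiffAt ℝ 1 Q x :=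
    (hQ.of_le (by norm_cast)).eventually (by simp)
  have hjx : ∀ᶠ x in 𝓝 x₀, sinT j (proj x) ≠ 0 :=
    ((contDiff_sinT j).continuous.continuousAt).eventually_ne hj
  filter_upwards [hQ1, hjx, hf.eventually_nhds] with x hQx hjx hfx
  unfold symbolQuotient
  split_ifs with hx hex
  · set i := hex.choose
    have hi : sinT i (proj x) ≠ 0 := hex.choose_spec
    have hline : HasDerivAt (fun t : ℝ => x + (Pi.single i t : Fin d → ℝ)) (Pi.single i 1) 0 := by
      have := (ContinuousLinearMap.single ℝ (fun _ : Fin d => ℝ) i).hasDerivAt (x := 0)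
      simpa using this.const_add x
    have hx0 : x + (Pi.single i (0 : ℝ) : Fin d → ℝ) = x := by simp
    have hQd : HasDerivAt (fun t : ℝ => Q (x + Pi.single i t)) (fderiv ℝ Q x (Pi.single i 1)) 0 := by
      have h1 : HasFDerivAt Q (fderiv ℝ Q x) (x + Pi.single i (0 : ℝ)) := by
        rw [hx0]; exact (hQx.differentiableAt (by simp)).hasFDerivAt
      exact h1.comp_hasDerivAt 0 hline
    have hsd := ((hasDerivAt_symbol i (proj x) 0).sub_const lam).ofReal_comp
    have hprod := hsd.fun_mul hQd
    have heq : (fun t : ℝ => f (proj x + axis i t)) =ᶠ[𝓝 0] fun t : ℝ =>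
        ((symbol (proj x + axis i t) - lam : ℝ) : ℂ) * Q (x + Pi.single i t) := by
      have ht : Tendsto (fun t : ℝ => x + (Pi.single i t : Fin d → ℝ)) (𝓝 0) (𝓝 x) := by
        have := hline.continuousAt.tendsto
        rwa [hx0] at this
      filter_upwards [ht.eventually hfx] with t ht
      rw [proj_add_axis, ht]
    have hpd : partialDeriv i f (proj x) = ((sinT i (proj x) / 2 : ℝ) : ℂ) * Q x := by
      rw [partialDeriv, heq.deriv_eq, hprod.deriv]
      simp [axis_zero, hx]
    rw [hpd, mul_div_cancel_left₀]
    exact_mod_cast div_ne_zero hi two_ne_zero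
  · exact absurd ⟨j, hjx⟩ hex
  · rw [hfx.self_of_nhds]
    exact mul_div_cancel_left₀ _ (by exact_mod_cast sub_ne_zero.mpr hx)

theorem sngWeight_pos_iff {lam : ℝ} {x : Torus d} :
    0 < sngWeight lam x ↔ symbol x ≠ lam ∨ ∃ j, sinT j x ≠ 0 := by
  constructor
  · intro h
    by_contra hcon
    push Not at hcon
    rw [sngWeight, hcon.1, sub_self, Finset.sum_eq_zero fun j _ => by rw [hcon.2 j]; simp] at h
    simp at h
  · rintro (h | ⟨j, hj⟩)
    · have h1 : 0 < (symbol x - lam) ^ 2 := by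
        have := sub_ne_zero.mpr h; positivity
      have h2 : 0 ≤ ∑ j, sinT j x ^ 2 := Finset.sum_nonneg fun _ _ => sq_nonneg _
      unfold sngWeight; linarith
    · exact lt_of_lt_of_le (by positivity) (sinT_sq_le_sngWeight lam j x)

theorem contDiffAt_symbolQuotient {fhat : (Fin d → ℤ) → ℂ} {lam : ℝ}
    (hfin : (Function.support fhat).Finite)
    (hvan : ∀ (j : Fin d) (x : Torus d), symbol x = lam → sinT j x ≠ 0 → trigPoly fhat x = 0)
    {x₀ : Fin d → ℝ} (hx₀ : 0 < sngWeight lam (proj x₀))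
    (hsm : ContDiff ℝ ∞ fun x : Fin d → ℝ => trigPoly fhat (proj x)) :
    ContDiffAt ℝ ∞ (fun x => symbolQuotient lam (trigPoly fhat) (proj x)) x₀ := by
  by_cases h : symbol (proj x₀) = lam
  · obtain ⟨j, hj⟩ := (sngWeight_pos_iff.mp hx₀).resolve_left (not_not.mpr h)
    obtain ⟨Q, hQ, hfQ⟩ := exists_eventually_eq_symbol_mul hfin (hvan j) h hj
    exact hQ.congr_of_eventuallyEq (symbolQuotient_eventuallyEq hj hQ hfQ)
  · have hs : ContDiff ℝ ∞ fun x : Fin d → ℝ => ((symbol (proj x) - lam : ℝ) : ℂ) :=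
      Complex.ofRealCLM.contDiff.comp (contDiff_symbol.sub contDiff_const)
    have hne : ((symbol (proj x₀) - lam : ℝ) : ℂ) ≠ 0 := by
      exact_mod_cast sub_ne_zero.mpr h
    refine (contDiffAt_complex_div hsm.contDiffAt hs.contDiffAt hne).congr_of_eventuallyEq ?_
    filter_upwards [(contDiff_symbol.continuous.continuousAt).eventually_ne h] with x hx
    simp [symbolQuotient, hx]

theorem symbol_mul_symbolQuotient {f : Torus d → ℂ} {lam : ℝ}
    (hvan : ∀ (j : Fin d) (x : Torus d), symbol x = lam → sinT j x ≠ 0 → f x = 0)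
    {x : Torus d} (hx : 0 < sngWeight lam x) :
    f x = symbolQuotient lam f x * ((symbol x - lam : ℝ) : ℂ) := by
  by_cases h : symbol x = lam
  · obtain ⟨j, hj⟩ := (sngWeight_pos_iff.mp hx).resolve_left (not_not.mpr h)
    rw [hvan j x h hj, h, sub_self, Complex.ofReal_zero, mul_zero]
  · have hne : ((symbol x - lam : ℝ) : ℂ) ≠ 0 := by exact_mod_cast sub_ne_zero.mpr h
    rw [symbolQuotient, if_neg h, div_mul_cancel₀ _ hne]

/-! ### Representation off the singular set -/

/-- On the compact set K the weight has a positive minimum; off K the function is zero. -/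
theorem exists_norm_le_mul_sngWeight {lam : ℝ} {F : Torus d → ℂ} (hF : Continuous F)
    {K : Set (Torus d)} (hK : IsClosed K) (hFK : ∀ x ∉ K, F x = 0)
    (hq : ∀ x ∈ K, 0 < sngWeight lam x) :
    ∃ C, 0 ≤ C ∧ ∀ x, ‖F x‖ ≤ C * sngWeight lam x := by
  obtain ⟨B, hB0, hB⟩ := exists_norm_le hF
  rcases K.eq_empty_or_nonempty with rfl | hne
  · exact ⟨0, le_rfl, fun x => by rw [hFK x (Set.notMem_empty x)]; simp⟩
  obtain ⟨x₁, hx₁, hmin⟩ := hK.isCompact.exists_isMinOn hne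
    (continuous_sngWeight (d := d) lam).continuousOn
  have hm := hq x₁ hx₁
  refine ⟨B / sngWeight lam x₁, by positivity, fun x => ?_⟩
  by_cases hx : x ∈ K
  · have h1 : sngWeight lam x₁ ≤ sngWeight lam x := hmin hx
    rw [div_mul_eq_mul_div, le_div_iff₀ hm]
    exact mul_le_mul (hB x) h1 hm.le hB0
  · rw [hFK x hx, norm_zero]
    have := sngWeight_nonneg lam x
    positivity

theorem partialDeriv_eq_zero_of_notMem_tsupport {F : Torus d → ℂ} {x : Torus d}
    (hx : x ∉ tsupport F) (j : Fin d) : partialDeriv j F x = 0 := by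
  have h := notMem_tsupport_iff_eventuallyEq.mp hx
  have ht : Tendsto (fun t : ℝ => x + axis j t) (𝓝 0) (𝓝 x) := by
    simpa [axis_zero] using (continuous_const.add (continuous_axis j)).tendsto (0 : ℝ)
      (f := fun t : ℝ => x + axis j t)
  have h0 : (fun t : ℝ => F (x + axis j t)) =ᶠ[𝓝 0] fun _ => 0 := ht.eventually h
  rw [partialDeriv, h0.deriv_eq, deriv_const]

/-- Division by h − λ alone would leave room for a distribution carried by the surface. The
regularised division leaves the error u(φ · Lorentzian), which the decay sends to zero. -/
theorem VanishingMean.distr_eq_integral {v : (Fin d → ℤ) → ℂ} (hv : VanishingMean v) {lam : ℝ}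
    {f g : Torus d → ℂ} (hf : hv.distr.MulEq (symbolSub d lam) f)
    (hfg : ∀ x, 0 < sngWeight lam x → f x = g x * ((symbol x - lam : ℝ) : ℂ))
    (hg : ∀ x, 0 < sngWeight lam x → ContinuousAt g x)
    {φ : TestFun d} (hφ : ∀ x ∈ tsupport (φ : Torus d → ℂ), 0 < sngWeight lam x) :
    hv.distr.toLinearMap φ = ∫ x, g x * (φ : Torus d → ℂ) x := by
  have hK := isClosed_tsupport (φ : Torus d → ℂ)
  have hφ0 : ∀ x ∉ tsupport (φ : Torus d → ℂ), (φ : Torus d → ℂ) x = 0 := fun x hx =>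
    image_eq_zero_of_notMem_tsupport hx
  have hgφ : Continuous fun x => g x * (φ : Torus d → ℂ) x := by
    refine continuous_of_tsupport fun x hx => ?_
    have hx' : x ∈ tsupport (φ : Torus d → ℂ) := closure_mono (fun y hy => by
      rw [Function.mem_support] at hy ⊢
      exact right_ne_zero_of_mul hy) hx
    exact (hg x (hφ x hx')).mul (TestFun.continuous φ).continuousAt
  obtain ⟨C₁, hC₁, hb₁⟩ := exists_norm_le_mul_sngWeight hgφ hK
    (fun x hx => by rw [hφ0 x hx, mul_zero]) hφ
  have hsq : ∀ (F : Torus d → ℂ), Continuous F → (∀ x ∉ tsupport (φ : Torus d → ℂ), F x = 0) →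
      ∃ C, 0 ≤ C ∧ ∀ x, ‖F x‖ ^ 2 ≤ C * sngWeight lam x := by
    intro F hF hF0
    have hF2 : Continuous fun x => F x ^ 2 := hF.pow 2
    obtain ⟨C, hC, hb⟩ := exists_norm_le_mul_sngWeight hF2 hK
      (fun x hx => by rw [hF0 x hx]; simp) hφ
    exact ⟨C, hC, fun x => by simpa [norm_pow] using hb x⟩
  obtain ⟨C₂, hC₂, hb₂⟩ := hsq _ (TestFun.continuous φ) hφ0
  have hpd := fun j => hsq _ (TestFun.continuous_partialDeriv φ j)
    fun x hx => partialDeriv_eq_zero_of_notMem_tsupport hx j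
  choose C₃ hC₃ hb₃ using hpd
  have hS0 : 0 ≤ ∑ j, C₃ j := Finset.sum_nonneg fun j _ => hC₃ j
  obtain ⟨K, hK0, hKε⟩ := integral_sngWeight_mul_lorentz_le d lam
  rw [← sub_eq_zero, ← norm_le_zero_iff]
  refine le_of_forall_pos_le_add fun η hη => ?_
  obtain ⟨ε₀, hε₀, hε₀1, hup⟩ := hv.norm_distr_mul_symbolComp_le lam (C := C₂ + ∑ j, C₃ j)
    (by positivity)
    (φ := φ) (fun x => (hb₂ x).trans (mul_le_mul_of_nonneg_right (by linarith)
      (sngWeight_nonneg lam x)))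
    (fun j x => (hb₃ j x).trans (mul_le_mul_of_nonneg_right (by
      linarith [Finset.single_le_sum (f := C₃) (fun i _ => hC₃ i) (Finset.mem_univ j)])
      (sngWeight_nonneg lam x))) (η / 2) (by positivity)
  -- This choice gives C₁Kε ≤ η/2 for the integral error; the added 1 keeps the denominator
  -- positive.
  set ε := min ε₀ (η / (2 * (C₁ * K + 1))) with hε
  have hεpos : 0 < ε := lt_min hε₀ (by positivity)
  have hε1 : ε ≤ 1 := (min_le_left _ _).trans hε₀1
  have h2 := hup ε hεpos (min_le_left _ _) (lorentz ε) (contDiff_lorentz hεpos)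
    (lorentz_sq_le ε) (deriv_lorentz_sq_le hεpos)
  have hk : ContDiff ℝ ∞ fun s : ℝ => s / (s ^ 2 + ε ^ 2) :=
    contDiff_div_sq_add_sq hεpos contDiff_id
  -- The partition 1 = s · s/(s² + ε²) + ε²/(s² + ε²) with s = h − λ; the first summand is divisible
  -- by h − λ.
  have hfac : φ = symbolSub d lam * (φ * symbolComp lam _ hk)
      + φ * symbolComp lam _ (contDiff_lorentz hεpos) := by
    apply Subtype.ext
    funext x
    have hne : (symbol x - lam) ^ 2 + ε ^ 2 ≠ 0 := by positivity
    have hone : (symbol x - lam) * ((symbol x - lam) / ((symbol x - lam) ^ 2 + ε ^ 2))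
        + lorentz ε (symbol x - lam) = 1 := by
      rw [lorentz]; field_simp
    have hone' := congrArg (fun r : ℝ => (r : ℂ)) hone
    simp only [Complex.ofReal_add, Complex.ofReal_mul, Complex.ofReal_one] at hone'
    simp only [AddMemClass.coe_add, Pi.add_apply, MulMemClass.coe_mul, Pi.mul_apply,
      symbolComp_apply, symbolSub_apply]
    linear_combination -((φ : Torus d → ℂ) x) * hone'
  have hlc : Continuous fun x : Torus d => (lorentz ε (symbol x - lam) : ℂ) :=
    Complex.continuous_ofReal.comp (continuous_lorentz_symbol hεpos lam)
  have hint : ∫ x, f x * ((φ * symbolComp lam _ hk : TestFun d) : Torus d → ℂ) x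
      = (∫ x, g x * (φ : Torus d → ℂ) x)
        - ∫ x, g x * (φ : Torus d → ℂ) x * (lorentz ε (symbol x - lam) : ℂ) := by
    have hgl : Continuous fun x => g x * (φ : Torus d → ℂ) x * (lorentz ε (symbol x - lam) : ℂ) :=
      hgφ.mul hlc
    rw [← integral_sub (integrable_of_continuous hgφ) (integrable_of_continuous hgl)]
    refine integral_congr_ae (Eventually.of_forall fun x => ?_)
    simp only [MulMemClass.coe_mul, Pi.mul_apply, symbolComp_apply]
    by_cases hx : x ∈ tsupport (φ : Torus d → ℂ)
    · rw [hfg x (hφ x hx)]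
      have hne : (symbol x - lam) ^ 2 + ε ^ 2 ≠ 0 := by positivity
      have hone : (symbol x - lam) * ((symbol x - lam) / ((symbol x - lam) ^ 2 + ε ^ 2))
          + lorentz ε (symbol x - lam) = 1 := by
        rw [lorentz]; field_simp
      have hone' := congrArg (fun r : ℝ => (r : ℂ)) hone
      simp only [Complex.ofReal_add, Complex.ofReal_mul, Complex.ofReal_one] at hone'
      linear_combination (g x * (φ : Torus d → ℂ) x) * hone'
    · rw [hφ0 x hx]; ring
  have hrem : ‖∫ x, g x * (φ : Torus d → ℂ) x * (lorentz ε (symbol x - lam) : ℂ)‖ ≤ η / 2 := by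
    have hle : ∀ x, ‖g x * (φ : Torus d → ℂ) x * (lorentz ε (symbol x - lam) : ℂ)‖
        ≤ C₁ * (sngWeight lam x * lorentz ε (symbol x - lam)) := by
      intro x
      rw [norm_mul, Complex.norm_real, Real.norm_of_nonneg (lorentz_nonneg _ _), ← mul_assoc]
      exact mul_le_mul_of_nonneg_right (hb₁ x) (lorentz_nonneg _ _)
    have hqc : Continuous fun x : Torus d => C₁ * (sngWeight lam x * lorentz ε (symbol x - lam)) :=
      continuous_const.mul ((continuous_sngWeight lam).mul (continuous_lorentz_symbol hεpos lam))
    have h3 := norm_integral_le_of_norm_le (integrable_of_continuous hqc) (Eventually.of_forall hle)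
    rw [integral_const_mul] at h3
    have h4 := mul_le_mul_of_nonneg_left (hKε ε hεpos hε1) hC₁
    have h5 : ε ≤ η / (2 * (C₁ * K + 1)) := min_le_right _ _
    rw [le_div_iff₀ (by positivity)] at h5
    have : C₁ * (K * ε) ≤ η / 2 := by nlinarith
    linarith
  have hsplit : hv.distr.toLinearMap φ
      = (∫ x, f x * ((φ * symbolComp lam _ hk : TestFun d) : Torus d → ℂ) x)
        + hv.distr.toLinearMap (φ * symbolComp lam _ (contDiff_lorentz hεpos)) := by
    conv_lhs => rw [hfac]
    rw [map_add, hf]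
  rw [hsplit, hint, zero_add]
  calc _ = ‖hv.distr.toLinearMap (φ * symbolComp lam _ (contDiff_lorentz hεpos))
        - ∫ x, g x * (φ : Torus d → ℂ) x * (lorentz ε (symbol x - lam) : ℂ)‖ := by
        congr 1; ring
    _ ≤ η / 2 + η / 2 := (norm_sub_le _ _).trans (add_le_add h2 hrem)
    _ = η := by ring

/-! ### The singular set -/

/-- Modulo 2π, every integer multiple of π is 0 or π, according to its parity. -/
theorem finite_sngFermi (d : ℕ) (lam : ℝ) : (sngFermi d lam).Finite := by
  have hfin : (Set.pi Set.univ fun _ : Fin d => ({((0 : ℂ) : AddCircle (2 * (π : ℂ))),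
      ((π : ℂ) : AddCircle (2 * (π : ℂ)))} : Set (AddCircle (2 * (π : ℂ))))).Finite :=
    Set.Finite.pi fun _ => (Set.toFinite _)
  refine hfin.subset fun z hz j _ => ?_
  obtain ⟨k, hk⟩ := hz.2 j
  rw [hk]
  obtain ⟨m, hm | hm⟩ := Int.even_or_odd' k
  · left
    rw [AddCircle.coe_zero, AddCircle.coe_eq_zero_iff]
    exact ⟨m, by subst hm; push_cast; rw [zsmul_eq_mul]; ring⟩
  · right
    rw [Set.mem_singleton_iff, ← sub_eq_zero, ← AddCircle.coe_sub, AddCircle.coe_eq_zero_iff]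
    exact ⟨m, by subst hm; push_cast; rw [zsmul_eq_mul]; ring⟩

theorem sngWeight_pos_of_notMem {lam : ℝ} {x : Torus d} (hx : toComplexTorus x ∉ sngFermi d lam) :
    0 < sngWeight lam x := by
  rw [sngWeight_pos_iff]
  by_contra hcon
  push Not at hcon
  refine hx ⟨?_, fun j => ?_⟩
  · rw [complexFermi, Set.mem_ofPred_eq, complexSymbol_toComplexTorus, hcon.1]
  · obtain ⟨y, rfl⟩ := isOpenQuotientMap_proj.surjective x
    have h := hcon.2 j
    rw [sinT_proj, Real.sin_eq_zero_iff] at h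
    obtain ⟨k, hk⟩ := h
    refine ⟨k, ?_⟩
    change ((y j : ℂ) : AddCircle (2 * (π : ℂ))) = _
    rw [← hk]
    push_cast
    rfl

/-- The trigonometric polynomial of a finitely supported sequence as a test function. -/
def trigTest {fhat : (Fin d → ℤ) → ℂ} (hf : (Function.support fhat).Finite) : TestFun d :=
  fourierConst d • ∑ n ∈ hf.toFinset, fhat n • expiTest (-n)

theorem trigTest_coe {fhat : (Fin d → ℤ) → ℂ} (hf : (Function.support fhat).Finite) :
    ((trigTest hf : TestFun d) : Torus d → ℂ) = trigPoly fhat := by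
  funext x
  rw [trigPoly_eq_sum hf]
  simp [trigTest, expiTest_coe, AddSubmonoidClass.coe_finsetSum]

end

end DiscreteHelmholtz

/-! ### The main theorem -/

theorem mainTheorem2 (d : ℕ) (hd : 2 ≤ d) (lam : ℝ) (hlam : lam ∈ Set.Ioo (0 : ℝ) (d : ℝ))
    (R₀ : ℝ) (hR₀ : 0 < R₀) (uhat : (Fin d → ℤ) → ℂ)
    (hequation : ∀ n : Fin d → ℤ, R₀ < latticeNorm n → helmholtz lam uhat n = 0)
    (hdecay : DecayCondition R₀ uhat) :
    (sngFermi d lam).Finite ∧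
    (Function.support (helmholtz lam (zeroExtension R₀ uhat))).Finite ∧
    ∃ u : Distr d,
      u.IsFourierSeries (zeroExtension R₀ uhat) ∧
      u.MulEq (symbolSub d lam) (trigPoly (helmholtz lam (zeroExtension R₀ uhat))) ∧
      u.IsSmoothOn {x : Torus d | toComplexTorus x ∉ sngFermi d lam} ∧
      ∀ x : Torus d, toComplexTorus x ∈ regFermi d lam →
        trigPoly (helmholtz lam (zeroExtension R₀ uhat)) x = 0 := by
  have hv := vanishingMean_zeroExtension hdecay
  have hfin := finite_support_helmholtz hequation
  have hmul := hv.mulEq hfin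
  have hvan : ∀ (j : Fin d) (x : Torus d), symbol x = lam → sinT j x ≠ 0 →
      trigPoly (helmholtz lam (zeroExtension R₀ uhat)) x = 0 := by
    intro j x hx hj
    rw [← trigTest_coe hfin] at hmul ⊢
    exact hv.eq_zero_of_mulEq hmul hx hj
  have hsm : ContDiff ℝ ∞ fun x : Fin d → ℝ =>
      trigPoly (helmholtz lam (zeroExtension R₀ uhat)) (proj x) := by
    rw [← trigTest_coe hfin]
    exact TestFun.contDiff (trigTest hfin)
  have hsmooth := fun (x₀ : Fin d → ℝ) (hx₀ : 0 < sngWeight lam (proj x₀)) =>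
    contDiffAt_symbolQuotient hfin hvan hx₀ hsm
  refine ⟨finite_sngFermi d lam, hfin, hv.distr, hv.isFourierSeries, hmul,
    ⟨symbolQuotient lam (trigPoly (helmholtz lam (zeroExtension R₀ uhat))), ?_, ?_⟩, ?_⟩
  · exact fun x hx => (hsmooth x (sngWeight_pos_of_notMem hx)).contDiffWithinAt
  · intro φ hφ
    refine hv.distr_eq_integral hmul (fun x hx => symbol_mul_symbolQuotient hvan hx)
      (fun x hx => ?_) fun x hx => sngWeight_pos_of_notMem (hφ hx)
    obtain ⟨y, rfl⟩ := isOpenQuotientMap_proj.surjective x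
    -- Continuity of the lift descends to the torus because the covering map is an open quotient
    -- map.
    exact isOpenQuotientMap_proj.continuousAt_comp_iff.mp (hsmooth y hx).continuousAt
  · intro x hx
    have hs : symbol x = lam := by
      have := hx.1
      rw [complexFermi, Set.mem_ofPred_eq, complexSymbol_toComplexTorus] at this
      exact_mod_cast this
    obtain ⟨j, hj⟩ := (sngWeight_pos_iff.mp (sngWeight_pos_of_notMem hx.2)).resolve_left
      (not_not.mpr hs)
    exact hvan j x hs hj
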